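/- **Conventions.** Let $\mathcal A$ be an abelian category and $\mathcal E\subseteq\mathcal A$ a strictly full additive subcategory closed under extensions. Let $\mathcal Ex$ be the class of sequences in $\mathcal E$ that are short exact in $\mathcal A$ (*conflations* $X\rightarrowtail Y\twoheadrightarrow Z$, consisting of an *inflation* and a *deflation*). More generally, let $(\mathcal E,\mathcal Ex)$ be an additive category with a Quillen exact structure. A *$D(\mathcal E,\mathcal Ex)$-kernel* of $f:X\to Y$ is a morphism $i:K\to X$ with $fi=0$ such that for every $j:W\to X$ with $fj=0$ there are a deflation $\pi:N\twoheadrightarrow W$ and $k:N\to K$ with $j\pi=ik$. *$D(\mathcal E,\mathcal Ex)$-cokernels* are defined dually. For $n\ge 2$, $(\mathcal E,\mathcal Ex)$ is *$n$-quasi-abelian* if $\mathcal E$ is idempotent complete, every morphism has a $D(\mathcal E,\mathcal Ex)$-kernel and a $D(\mathcal E,\mathcal Ex)$-cokernel, and 1. in every sequence $K^{-n+1}\to\cdots\to K^0$ in $\mathcal E$ in which each map is a $D(\mathcal E,\mathcal Ex)$-kernel of the next one, the first map $K^{-n+1}\to K^{-n+2}$ has a kernel in $\mathcal E$; 2. in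 every sequence $C^{-n+1}\to\cdots\to C^0$ in $\mathcal E$ in which each map is a $D(\mathcal E,\mathcal Ex)$-cokernel of the preceding one, the last map $C^{-1}\to C^0$ has a cokernel in $\mathcal E$. For $n=1$ it is *$1$-quasi-abelian* if $\mathcal E$ has kernels and cokernels, pushouts of kernels are kernels, pullbacks of cokernels are cokernels, and $\mathcal Ex$ consists of all kernel-cokernel pairs. For $n\ge1$, a strictly full additive subcategory $\mathcal E\subseteq\mathcal A$ is an *$n$-tilting torsion class* if (i) every object of $\mathcal A$ is a subobject of an object of $\mathcal E$; (ii) $\mathcal E$ is closed under extensions in $\mathcal A$; (iii) every morphism of $\mathcal E$ has a $D(\mathcal E,\mathcal Ex)$-kernel, for the induced $\mathcal Ex$; (iv) for every exact sequence $0\to A\to X_n\to\cdots\to X_1\to B\to0$ in $\mathcal A$ with all $X_i\in\mathcal E$ one has $B\in\mathcal E$. Let $K(\mathcal E)$ be the homotopy category of unbounded cochain complexes in $\mathcal E$ and $\mathcal N_{\mathcal Ex}\subseteq K(\mathcal E)$ the full subcategory of the objects isomorphic to *acyclic* complexes $X^\bullet$, those for which $d^i=m_ie_i$ with conflations $D^i\xrightarrow{m_i}X^{i+1}\xrightarrow{e_{i+1}}D^{i+1}$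 for all $i\in\mathbb Z$. Put $D(\mathcal E,\mathcal Ex)=K(\mathcal E)/\mathcal N_{\mathcal Ex}$, and for $m\in\mathbb Z$ let $\mathcal{RD}^{\ge m}$ be the class of objects of $D(\mathcal E,\mathcal Ex)$ isomorphic to complexes in $\mathcal E$ vanishing in degrees $<m$. **Theorem.** Let $n\ge1$ and let $\mathcal E$ be an $n$-tilting torsion class in an abelian category $\mathcal A$, with the induced class $\mathcal Ex$. Then: 1. $\mathcal Ex$ is a Quillen exact structure on $\mathcal E$ and $(\mathcal E,\mathcal Ex)$ is an $n$-quasi-abelian category. 2. If $n\ge2$, a sequence $C^{-n+1}\to\cdots\to C^{-1}\to C^0$ in $\mathcal E$ is exact in $\mathcal A$ (at $C^{-n+2},\dots,C^{-1}$) if and only if, for every $-n+3\le i\le 0$, $d^{i-1}:C^{i-1}\to C^i$ is a $D(\mathcal E,\mathcal Ex)$-cokernel of $d^{i-2}$, and $d^{-1}:C^{-1}\to C^0$ has a cokernel in $\mathcal E$. 3. $\mathcal N_{\mathcal Ex}$ is a triangulated subcategory of $K(\mathcal E)$, and the functor $K(\mathcal E)\to K(\mathcal A)\to D(\mathcal A)$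 induces an equivalence of triangulated categories $\Phi:K(\mathcal E)/\mathcal N_{\mathcal Ex}\xrightarrow{\ \cong\ }D(\mathcal A)$. 4. There is a $t$-structure on $D(\mathcal E,\mathcal Ex)$ whose classes of objects of degree $\ge m$ are the $\mathcal{RD}^{\ge m}$. If $\mathcal{RH}(\mathcal E,\mathcal Ex)$ denotes its heart, there is an equivalence $\mathcal A\cong\mathcal{RH}(\mathcal E,\mathcal Ex)$ whose restriction to $\mathcal E$ is isomorphic to the functor placing an object in degree $0$, and whose composition with $\Phi$ is isomorphic to the canonical embedding $\mathcal A\to D(\mathcal A)$. -/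

import Mathlib

open CategoryTheory CategoryTheory.Limits

universe w v u

noncomputable section

namespace NQuasiAbelian

/-! ### Exact categories in the sense of Quillen -/

section Exact

variable {E : Type u} [Category.{v} E] [Preadditive E]

/-- A sequence `A ⟶ B ⟶ C` in which the first map is a kernel of the second one
and the second map is a cokernel of the first one. -/
def IsKernelCokernelPair (S : ShortComplex E) : Prop :=
  Nonempty (IsLimit (KernelFork.ofι S.f S.zero)) ∧
    Nonempty (IsColimit (CokernelCofork.ofπ S.g S.zero))

/-- For a class `Ex` of sequences `A ⟶ B ⟶ C` (the conflations), a morphism is an inflation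
if it is the first map of a conflation. -/
def IsInflation (Ex : ObjectProperty (ShortComplex E)) {X Y : E} (i : X ⟶ Y) : Prop :=
  ∃ (Z : E) (p : Y ⟶ Z) (h : i ≫ p = 0), Ex (ShortComplex.mk i p h)

/-- A morphism is a deflation if it is the second map of a conflation. -/
def IsDeflation (Ex : ObjectProperty (ShortComplex E)) {Y Z : E} (p : Y ⟶ Z) : Prop :=
  ∃ (X : E) (i : X ⟶ Y) (h : i ≫ p = 0), Ex (ShortComplex.mk i p h)

/-- Quillen exact structures on an additive category, given by their class of conflations. -/
structure IsQuillenExact (Ex : ObjectProperty (ShortComplex E)) : Prop where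
  closedUnderIso : Ex.IsClosedUnderIsomorphisms
  kernelCokernelPair (S : ShortComplex E) : Ex S → IsKernelCokernelPair S
  deflation_id_zero (Z : E) : IsZero Z → IsDeflation Ex (𝟙 Z)
  deflation_comp {X Y Z : E} (p : X ⟶ Y) (q : Y ⟶ Z) :
    IsDeflation Ex p → IsDeflation Ex q → IsDeflation Ex (p ≫ q)
  inflation_comp {X Y Z : E} (i : X ⟶ Y) (j : Y ⟶ Z) :
    IsInflation Ex i → IsInflation Ex j → IsInflation Ex (i ≫ j)
  pushout {X Y X' : E} (i : X ⟶ Y) (f : X ⟶ X') : IsInflation Ex i →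
    ∃ (Y' : E) (g : Y ⟶ Y') (j : X' ⟶ Y'), IsPushout i f g j ∧ IsInflation Ex j
  pullback {Y Z Z' : E} (p : Y ⟶ Z) (f : Z' ⟶ Z) : IsDeflation Ex p →
    ∃ (Y' : E) (g : Y' ⟶ Y) (q : Y' ⟶ Z'), IsPullback g q p f ∧ IsDeflation Ex q

/-- `i : K ⟶ X` is a `D(E, Ex)`-kernel of `f : X ⟶ Y`: the composition is zero, and any
morphism to `X` killed by `f` factors through `i` after composition with a deflation. -/
def IsDKernel (Ex : ObjectProperty (ShortComplex E)) {K X Y : E} (i : K ⟶ X) (f : X ⟶ Y) :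
    Prop :=
  i ≫ f = 0 ∧ ∀ (W : E) (j : W ⟶ X), j ≫ f = 0 →
    ∃ (N : E) (π : N ⟶ W) (k : N ⟶ K), IsDeflation Ex π ∧ π ≫ j = k ≫ i

/-- `p : Y ⟶ C` is a `D(E, Ex)`-cokernel of `f : X ⟶ Y`. -/
def IsDCokernel (Ex : ObjectProperty (ShortComplex E)) {X Y C : E} (f : X ⟶ Y) (p : Y ⟶ C) :
    Prop :=
  f ≫ p = 0 ∧ ∀ (W : E) (j : Y ⟶ W), f ≫ j = 0 →
    ∃ (N : E) (ι : W ⟶ N) (k : C ⟶ N), IsInflation Ex ι ∧ j ≫ ι = p ≫ k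

/-- Any morphism has a `D(E, Ex)`-kernel. -/
def HasDKernels (Ex : ObjectProperty (ShortComplex E)) : Prop :=
  ∀ (X Y : E) (f : X ⟶ Y), ∃ (K : E) (i : K ⟶ X), IsDKernel Ex i f

/-- Any morphism has a `D(E, Ex)`-cokernel. -/
def HasDCokernels (Ex : ObjectProperty (ShortComplex E)) : Prop :=
  ∀ (X Y : E) (f : X ⟶ Y), ∃ (C : E) (p : Y ⟶ C), IsDCokernel Ex f p

/-- In a sequence of `l + 1` composable objects, each map is a `D(E, Ex)`-kernel of the next. -/
def IsDKernelSequence (Ex : ObjectProperty (ShortComplex E)) {l : ℕ}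
    (S : ComposableArrows E l) : Prop :=
  ∀ (i : ℕ) (hi : i + 2 ≤ l),
    IsDKernel Ex (S.map' i (i + 1) (by omega) (by omega))
      (S.map' (i + 1) (i + 2) (by omega) (by omega))

/-- In a sequence of `l + 1` composable objects, each map is a `D(E, Ex)`-cokernel of the
preceding one. -/
def IsDCokernelSequence (Ex : ObjectProperty (ShortComplex E)) {l : ℕ}
    (S : ComposableArrows E l) : Prop :=
  ∀ (i : ℕ) (hi : i + 2 ≤ l),
    IsDCokernel Ex (S.map' i (i + 1) (by omega) (by omega))
      (S.map' (i + 1) (i + 2) (by omega) (by omega))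

variable (E) in
/-- Additive categories in which every idempotent splits. -/
structure IsProjectivelyComplete : Prop where
  hasZeroObject : HasZeroObject E
  hasBinaryBiproducts : HasBinaryBiproducts E
  isIdempotentComplete : IsIdempotentComplete E

/-- The conditions which, on a projectively complete category endowed with a Quillen exact
structure, define the `n`-quasi-abelian ones:
* `n = 0`: abelian categories with all the short exact sequences as conflations;
* `n = 1`: (Schneiders) quasi-abelian categories, with all the kernel-cokernel pairs as
  conflations;
* `n = m + 2`: there are `D(E, Ex)`-kernels and `D(E, Ex)`-cokernels; in any sequence of
  `n` objects and `n - 1` maps each of which is a `D(E, Ex)`-kernel of the next one, the first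
  map has a kernel; and dually. -/
def NQuasiAbelianCondition (Ex : ObjectProperty (ShortComplex E)) : ℕ → Prop
  | 0 => (HasKernels E ∧ HasCokernels E ∧ IsNormalMonoCategory E ∧ IsNormalEpiCategory E) ∧
      ∀ S, Ex S ↔ IsKernelCokernelPair S
  | 1 => (HasKernels E ∧ HasCokernels E) ∧
      (∀ (X Y X' Y' : E) (i : X ⟶ Y) (f : X ⟶ X') (g : Y ⟶ Y') (j : X' ⟶ Y'),
        IsPushout i f g j → Nonempty (NormalMono i) → Nonempty (NormalMono j)) ∧
      (∀ (Y Z Y' Z' : E) (p : Y ⟶ Z) (f : Z' ⟶ Z) (g : Y' ⟶ Y) (q : Y' ⟶ Z'),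
        IsPullback g q p f → Nonempty (NormalEpi p) → Nonempty (NormalEpi q)) ∧
      ∀ S, Ex S ↔ IsKernelCokernelPair S
  | m + 2 => HasDKernels Ex ∧ HasDCokernels Ex ∧
      (∀ S : ComposableArrows E (m + 1), IsDKernelSequence Ex S → HasKernel (S.map' 0 1)) ∧
      (∀ S : ComposableArrows E (m + 1), IsDCokernelSequence Ex S →
        HasCokernel (S.map' m (m + 1)))

/-- `n`-quasi-abelian categories `(E, Ex)`. -/
structure IsNQuasiAbelian (n : ℕ) (Ex : ObjectProperty (ShortComplex E)) : Prop where
  isProjectivelyComplete : IsProjectivelyComplete E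
  isQuillenExact : IsQuillenExact Ex
  condition : NQuasiAbelianCondition Ex n

/-! ### The derived category of an exact category -/

/-- A complex is acyclic if its differentials factor as `X i ↠ Z i ↣ X (i + 1)` in such
a way that the sequences `Z i ↣ X (i + 1) ↠ Z (i + 1)` are conflations. -/
def IsAcyclic (Ex : ObjectProperty (ShortComplex E)) (K : CochainComplex E ℤ) : Prop :=
  ∃ (Z : ℤ → E) (e : ∀ i, K.X i ⟶ Z i) (m : ∀ i, Z i ⟶ K.X (i + 1)),
    (∀ i, e i ≫ m i = K.d i (i + 1)) ∧
    ∀ i, ∃ h : m i ≫ e (i + 1) = 0, Ex (ShortComplex.mk (m i) (e (i + 1)) h)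

/-- The (strictly) full subcategory of acyclic complexes in the homotopy category `K(E)`. -/
def acyclicComplexes (Ex : ObjectProperty (ShortComplex E)) :
    ObjectProperty (HomotopyCategory E (ComplexShape.up ℤ)) := fun X ↦
  ∃ K : CochainComplex E ℤ, IsAcyclic Ex K ∧
    Nonempty (X ≅ (HomotopyCategory.quotient E (ComplexShape.up ℤ)).obj K)

variable [HasZeroObject E] [HasBinaryBiproducts E]

/-- The derived category `D(E, Ex)`: the Verdier quotient of `K(E)` by acyclic complexes,
that is, the localization of `K(E)` at the morphisms whose cone is acyclic. -/
abbrev ExactDerivedCategory (Ex : ObjectProperty (ShortComplex E)) :=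
  (acyclicComplexes Ex).trW.Localization

/-- The quotient functor `K(E) ⥤ D(E, Ex)`. -/
abbrev quotientFunctor (Ex : ObjectProperty (ShortComplex E)) :
    HomotopyCategory E (ComplexShape.up ℤ) ⥤ ExactDerivedCategory Ex :=
  (acyclicComplexes Ex).trW.Q

/-- The class `RD^{≥ m}` of the objects of `D(E, Ex)` which are isomorphic to complexes
with entries in `E` that vanish in degrees `< m`. -/
def rightCoaisle (Ex : ObjectProperty (ShortComplex E)) (m : ℤ) :
    ObjectProperty (ExactDerivedCategory Ex) := fun X ↦
  ∃ K : CochainComplex E ℤ, (∀ i, i < m → IsZero (K.X i)) ∧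
    Nonempty (X ≅ (quotientFunctor Ex).obj
      ((HomotopyCategory.quotient E (ComplexShape.up ℤ)).obj K))

end Exact

/-! ### Tilting torsion classes -/

section Tilting

variable {A : Type u} [Category.{v} A] [Abelian A]

/-- The class of the sequences in a full subcategory of an abelian category which are
short exact in the abelian category. -/
def inducedExactStructure (P : ObjectProperty A) :
    ObjectProperty (ShortComplex P.FullSubcategory) :=
  fun S ↦ (S.map P.ι).ShortExact

/-- `n`-tilting torsion classes in an abelian category `A`: (strictly) full additive subcategories
which cogenerate `A`, are closed under extensions, have `D(E, Ex)`-kernels, and contain `B`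
whenever there is an exact sequence
`0 ⟶ A ⟶ X_n ⟶ ⋯ ⟶ X_1 ⟶ B ⟶ 0` in `A` with all the `X_i` in the subcategory. -/
structure IsNTiltingTorsionClass (n : ℕ) (P : ObjectProperty A) : Prop where
  closedUnderIso : P.IsClosedUnderIsomorphisms
  containsZero : P.ContainsZero
  cogenerates (X : A) : ∃ (Y : A) (i : X ⟶ Y), P Y ∧ Mono i
  closedUnderExtensions : P.IsClosedUnderExtensions
  hasDKernels : HasDKernels (inducedExactStructure P)
  prop_of_exact (S : ComposableArrows A (n + 1)) : S.Exact → Mono (S.map' 0 1) →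
    Epi (S.map' n (n + 1)) →
    (∀ (i : ℕ) (_ : 1 ≤ i) (_ : i ≤ n), P (S.obj' i (by omega))) → P (S.obj' (n + 1))

variable {n : ℕ} {P : ObjectProperty A}

lemma IsNTiltingTorsionClass.hasZeroObject (hP : IsNTiltingTorsionClass n P) :
    HasZeroObject P.FullSubcategory := by
  have := hP.containsZero
  infer_instance

lemma IsNTiltingTorsionClass.hasBinaryBiproducts (hP : IsNTiltingTorsionClass n P) :
    HasBinaryBiproducts P.FullSubcategory := by
  have := hP.closedUnderIso
  have := hP.closedUnderExtensions
  have : P.IsClosedUnderBinaryProducts := .mk' <| by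
    rintro _ ⟨F, hF⟩
    refine P.prop_of_iso ?_ (P.prop_biprod (hF ⟨.left⟩) (hF ⟨.right⟩))
    exact biprod.isoProd _ _ ≪≫ (HasLimit.isoOfNatIso (diagramIsoPair F)).symm
  exact HasBinaryBiproducts.of_hasBinaryProducts

end Tilting

end NQuasiAbelian

end

/-! Write `E` for the subcategory given by `P`, and call `M` an `r`-cosyzygy if it ends an exact
sequence `X_r ⟶ ⋯ ⟶ X_1 ⟶ M ⟶ 0` with all `X_i` in `E`. The last axiom says that `n`-cosyzygies lie
in `E`, and most of the proof consists in producing cosyzygies. If an `r`-cosyzygy is embedded in an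
object of `E`, the quotient is an `(r + 1)`-cosyzygy; hence every object or complex of `A` is
coresolved by `E` in `n` steps (`exists_resolution`). If a complex over `E` is exact in all degrees
below `m`, its opcycles up to degree `m` are cosyzygies of every order, hence in `E`
(`prop_opcycles`).

So acyclicity for the exact structure is exactness in `A`, and roofs in `K(A)` can be dominated by
roofs in `K(E)`: this gives the equivalence `Φ`. The t-structure is transported along `Φ`;
truncation below introduces only opcycles, so it preserves complexes over `E`.

Since `E` cogenerates, `D`-cokernels are exactness in `A`, and the final cokernel of an exact
sequence of `n` terms is an `n`-cosyzygy. Kernels are harder, as `D`-exactness is only tested on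
objects of `E`. Extend the given sequence to the left by `D`-kernels, to a complex `L`. Maps from
objects of `E` to suitable shifts of `L` in `D(A)` are effaced by epimorphisms with kernel in `E`
(`isEffaceable_of_isDExactAt`); by dimension shifting this passes to all objects of `A`
(`isEffaceable_of_isCosyzygy`). Effacing the inclusion of the cycles shows that `L` is exact in
degrees `< -n`. Then its opcycles in degree `-n` lie in `E` and are the required kernel. For `n =
1`, `E` is closed under quotients, and images of `D`-kernels are kernels. -/

noncomputable section

namespace NQuasiAbelian

/-! ### Cosyzygies and closure properties of the class -/

section Cosyzygies

variable {A : Type u} [Category.{v} A] [Abelian A]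

/-- The objects `M` which fit in an exact sequence `X_r ⟶ ⋯ ⟶ X_1 ⟶ M ⟶ 0` with the `X_i` in a
class of objects `P`. -/
def IsCosyzygy (P : ObjectProperty A) : ℕ → ObjectProperty A
  | 0 => fun _ ↦ True
  | r + 1 => fun M ↦ ∃ (K V : A) (i : K ⟶ V) (p : V ⟶ M) (w : i ≫ p = 0),
      (ShortComplex.mk i p w).ShortExact ∧ P V ∧ IsCosyzygy P r K

lemma isCosyzygy_succ_of_epi {P : ObjectProperty A} {r : ℕ} {V M : A} (p : V ⟶ M) [Epi p]
    (hV : P V) (h : IsCosyzygy P r (kernel p)) : IsCosyzygy P (r + 1) M :=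
  ⟨_, _, kernel.ι p, p, by simp, { exact := ShortComplex.exact_kernel p }, hV, h⟩

lemma IsCosyzygy.of_shortExact {P : ObjectProperty A} {r : ℕ} {S : ShortComplex A}
    (hS : S.ShortExact) (h₁ : IsCosyzygy P r S.X₁) (h₂ : P S.X₂) :
    IsCosyzygy P (r + 1) S.X₃ :=
  ⟨_, _, _, _, S.zero, hS, h₂, h₁⟩

variable {n : ℕ} {P : ObjectProperty A} (hP : IsNTiltingTorsionClass n P)

include hP in
-- Splicing: `K ⟶ V ⟶ S₀` replaces the first object of `S` by `K` and `V`, which trades one unit of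
-- `r` for one of `k`. At `r = 0` this is the axiom on exact sequences.
lemma IsNTiltingTorsionClass.prop_of_exact_of_isCosyzygy (r : ℕ) :
    ∀ (k : ℕ) (_ : k + r = n) (S : ComposableArrows A (k + 1)), S.Exact → Mono (S.map' 0 1) →
      Epi (S.map' k (k + 1)) →
      (∀ (i : ℕ) (_ : 1 ≤ i) (_ : i ≤ k), P (S.obj' i (by omega))) →
      IsCosyzygy P r (S.obj' 0) → P (S.obj' (k + 1)) := by
  induction r with
  | zero =>
    rintro k rfl S hS h₁ h₂ h₃ -
    exact hP.prop_of_exact S hS h₁ h₂ h₃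
  | succ r hr =>
    rintro k hk S hS h₁ h₂ h₃ ⟨K, V, i, p, w, hT, hV, hK⟩
    obtain ⟨F, M, f, rfl⟩ := ComposableArrows.precomp_surjective S
    change V ⟶ M at p
    have hf : Mono f := h₁
    have hp : Epi p := hT.epi_g
    have hi : Mono i := hT.mono_f
    have hipf : i ≫ p ≫ f = 0 := by
      rw [← Category.assoc]
      exact (congr_arg (· ≫ f) w).trans zero_comp
    refine hr (k + 1) (by omega) ((F.precomp (p ≫ f)).precomp i) ?_ hi ?_ ?_ hK
    · refine ComposableArrows.exact_of_δ₀ ?_ ?_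
      · refine ComposableArrows.exact₂_mk _ hipf ?_
        change (ShortComplex.mk i (p ≫ f) _).Exact
        let φ : ShortComplex.mk i p w ⟶ ShortComplex.mk i (p ≫ f) hipf := { τ₁ := 𝟙 _, τ₂ := 𝟙 _, τ₃ := f }
        have : Epi φ.τ₁ := by dsimp [φ]; infer_instance
        have : IsIso φ.τ₂ := by dsimp [φ]; infer_instance
        have : Mono φ.τ₃ := hf
        exact (ShortComplex.exact_iff_of_epi_of_isIso_of_mono φ).1 hT.exact
      · change (F.precomp (p ≫ f)).Exact
        obtain _ | k := k
        · exact ComposableArrows.exact₁ _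
        · rw [ComposableArrows.exact_iff_δ₀] at hS
          refine ComposableArrows.exact_of_δ₀ ?_ hS.2
          have hfg : f ≫ F.map' 0 1 = 0 := hS.1.zero 0
          refine ComposableArrows.exact₂_mk _ (by
            change (p ≫ f) ≫ F.map' 0 1 = 0
            rw [Category.assoc, hfg, comp_zero]) ?_
          change (ShortComplex.mk (p ≫ f) (F.map' 0 1) _).Exact
          let φ : ShortComplex.mk (p ≫ f) (F.map' 0 1) (by
            rw [Category.assoc, hfg, comp_zero]) ⟶ ShortComplex.mk f (F.map' 0 1) hfg :=
            { τ₁ := p, τ₂ := 𝟙 _, τ₃ := 𝟙 _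
              comm₁₂ := (Category.comp_id _).symm
              comm₂₃ := (Category.id_comp _).trans (Category.comp_id _).symm }
          have : Epi φ.τ₁ := hp
          have : IsIso φ.τ₂ := by dsimp [φ]; infer_instance
          have : Mono φ.τ₃ := by dsimp [φ]; infer_instance
          exact (ShortComplex.exact_iff_of_epi_of_isIso_of_mono φ).2 (hS.1.exact 0)
    · obtain _ | k := k
      · have : Epi f := h₂
        change Epi (p ≫ f)
        infer_instance
      · exact h₂
    · rintro j hj hj'
      obtain _ | _ | j := j
      · omega
      · exact hV
      · exact h₃ (j + 1) (by omega) (by omega)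

include hP in
lemma IsNTiltingTorsionClass.prop_of_isCosyzygy {M : A} (h : IsCosyzygy P n M) : P M :=
  -- The splicing starts from the identity of `M`, which has no middle term.
  hP.prop_of_exact_of_isCosyzygy n 0 (by omega) (ComposableArrows.mk₁ (𝟙 M))
    (ComposableArrows.exact₁ _) (show Mono (𝟙 M) from inferInstance)
    (show Epi (𝟙 M) from inferInstance)
    (by intros; omega) h

include hP in
lemma IsNTiltingTorsionClass.prop_of_isZero {M : A} (h : IsZero M) : P M := by
  have := hP.closedUnderIso
  have := hP.containsZero
  exact P.prop_of_isZero h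

include hP in
lemma IsNTiltingTorsionClass.isCosyzygy_of_isZero {M : A} (h : IsZero M) (r : ℕ) :
    IsCosyzygy P r M := by
  induction r generalizing M with
  | zero => trivial
  | succ r hr =>
    have : Epi (0 : M ⟶ M) := ⟨fun _ _ _ ↦ h.eq_of_src _ _⟩
    exact isCosyzygy_succ_of_epi (0 : M ⟶ M) (hP.prop_of_isZero h)
      (hr (h.of_mono (kernel.ι _)))

include hP in
lemma IsNTiltingTorsionClass.isCosyzygy_of_prop {M : A} (h : P M) (r : ℕ) :
    IsCosyzygy P r M := by
  obtain _ | r := r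
  · trivial
  · exact isCosyzygy_succ_of_epi (𝟙 M) h (hP.isCosyzygy_of_isZero (isZero_kernel_of_mono _) r)

include hP in
/-- The class `P` contains the cokernels in `A` of the monomorphisms between objects of `P`. -/
lemma IsNTiltingTorsionClass.prop_X₃ (hn : 1 ≤ n) {S : ShortComplex A} (hS : S.ShortExact)
    (h₁ : P S.X₁) (h₂ : P S.X₂) : P S.X₃ := by
  obtain _ | n := n
  · omega
  · exact hP.prop_of_isCosyzygy (.of_shortExact hS (hP.isCosyzygy_of_prop h₁ _) h₂)

include hP in
lemma IsNTiltingTorsionClass.prop_X₂ {S : ShortComplex A} (hS : S.ShortExact)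
    (h₁ : P S.X₁) (h₃ : P S.X₃) : P S.X₂ := by
  have := hP.closedUnderExtensions
  exact P.prop_X₂_of_shortExact hS h₁ h₃

include hP in
lemma IsNTiltingTorsionClass.prop_of_iso {M N : A} (e : M ≅ N) (h : P M) : P N := by
  have := hP.closedUnderIso
  exact P.prop_of_iso e h

/-- The kernel of `p` is again a retract of `X`, through `𝟙 - p ≫ i`, so the resolution never stops.
This is the source of idempotent completeness. -/
lemma isCosyzygy_of_retract {X : A} (hX : P X) (r : ℕ) {M : A} (i : M ⟶ X) (p : X ⟶ M)
    (hip : i ≫ p = 𝟙 M) : IsCosyzygy P r M := by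
  induction r generalizing M with
  | zero => trivial
  | succ r hr =>
    have : Epi p := (IsSplitEpi.mk' ⟨i, hip⟩).epi
    refine isCosyzygy_succ_of_epi p hX (hr (kernel.ι p) (kernel.lift p (𝟙 _ - p ≫ i)
      (by simp [hip])) ?_)
    ext
    simp

include hP in
lemma IsNTiltingTorsionClass.prop_of_retract {X M : A} (hX : P X) (i : M ⟶ X) (p : X ⟶ M)
    (hip : i ≫ p = 𝟙 M) : P M :=
  hP.prop_of_isCosyzygy (isCosyzygy_of_retract hX n i p hip)

include hP in
lemma IsNTiltingTorsionClass.prop_biprod {X Y : A} (hX : P X) (hY : P Y) : P (X ⊞ Y) := by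
  have := hP.closedUnderExtensions
  exact P.prop_biprod hX hY

/-- Exactness identifies `cokernel S.f` with the image of `S.g`. Thus each exact spot of a sequence
raises the cosyzygy order of the cokernel by one. -/
lemma shortExact_cokernel_desc {S : ShortComplex A} (hS : S.Exact) :
    (ShortComplex.mk (cokernel.desc S.f S.g S.zero) (cokernel.π S.g)
      (by ext; simp)).ShortExact := by
  have := hS.mono_cokernelDesc
  let φ : ShortComplex.mk S.g (cokernel.π S.g) (by simp) ⟶
    ShortComplex.mk (cokernel.desc S.f S.g S.zero) (cokernel.π S.g) (by ext; simp) :=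
    { τ₁ := cokernel.π S.f, τ₂ := 𝟙 _, τ₃ := 𝟙 _ }
  have : Epi φ.τ₁ := by dsimp [φ]; infer_instance
  have : IsIso φ.τ₂ := by dsimp [φ]; infer_instance
  have : Mono φ.τ₃ := by dsimp [φ]; infer_instance
  exact { exact := (ShortComplex.exact_iff_of_epi_of_isIso_of_mono φ).1
            (ShortComplex.exact_cokernel S.g) }

lemma IsCosyzygy.cokernel_of_exact {r : ℕ} {S : ShortComplex A} (hS : S.Exact) (h₃ : P S.X₃)
    (h : IsCosyzygy P r (cokernel S.f)) : IsCosyzygy P (r + 1) (cokernel S.g) :=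
  .of_shortExact (shortExact_cokernel_desc hS) h h₃

lemma isCosyzygy_cokernel {X Y : A} (f : X ⟶ Y) (hX : P X) (hY : P Y) :
    IsCosyzygy P 2 (cokernel f) := by
  refine .of_shortExact (S := ShortComplex.mk (image.ι f) (cokernel.π f) ?_) ?_ ?_ hY
  · rw [← cancel_epi (factorThruImage f)]
    simp
  · let φ : ShortComplex.mk f (cokernel.π f) (by simp) ⟶
      ShortComplex.mk (image.ι f) (cokernel.π f) (by
        rw [← cancel_epi (factorThruImage f)]; simp) :=
      { τ₁ := factorThruImage f, τ₂ := 𝟙 _, τ₃ := 𝟙 _ }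
    have : Epi φ.τ₁ := by dsimp [φ]; infer_instance
    have : IsIso φ.τ₂ := by dsimp [φ]; infer_instance
    have : Mono φ.τ₃ := by dsimp [φ]; infer_instance
    exact { exact := (ShortComplex.exact_iff_of_epi_of_isIso_of_mono φ).1
              (ShortComplex.exact_cokernel f) }
  · exact isCosyzygy_succ_of_epi (factorThruImage f) hX trivial

end Cosyzygies

/-! ### The induced exact structure and `D`-cokernels -/

section InducedExactStructure

variable {A : Type u} [Category.{v} A] [Abelian A] {n : ℕ} {P : ObjectProperty A}
  (hP : IsNTiltingTorsionClass n P)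

include hP in
lemma IsNTiltingTorsionClass.prop_of_prop_kernel {M N : A} (f : M ⟶ N) [Epi f]
    (h₁ : P (kernel f)) (h₂ : P N) : P M :=
  hP.prop_X₂ (S := ShortComplex.mk (kernel.ι f) f (by simp))
    { exact := ShortComplex.exact_kernel f } h₁ h₂

include hP in
lemma IsNTiltingTorsionClass.prop_of_prop_cokernel {M N : A} (f : M ⟶ N) [Mono f]
    (h₁ : P M) (h₂ : P (cokernel f)) : P N :=
  hP.prop_X₂ (S := ShortComplex.mk f (cokernel.π f) (by simp))
    { exact := ShortComplex.exact_cokernel f } h₁ h₂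

include hP in
lemma IsNTiltingTorsionClass.prop_cokernel (hn : 1 ≤ n) {M N : A} (f : M ⟶ N) [Mono f]
    (h₁ : P M) (h₂ : P N) : P (cokernel f) :=
  hP.prop_X₃ hn (S := ShortComplex.mk f (cokernel.π f) (by simp))
    { exact := ShortComplex.exact_cokernel f } h₁ h₂

include hP in
lemma IsNTiltingTorsionClass.isInflation_iff (hn : 1 ≤ n) {X Y : P.FullSubcategory}
    (f : X ⟶ Y) : IsInflation (inducedExactStructure P) f ↔ Mono f.hom := by
  constructor
  · rintro ⟨Z, p, w, h⟩
    exact h.mono_f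
  · intro _
    have h : (ShortComplex.mk f.hom (cokernel.π f.hom) (by simp)).ShortExact :=
      { exact := ShortComplex.exact_cokernel _ }
    exact ⟨⟨cokernel f.hom, hP.prop_cokernel hn _ X.2 Y.2⟩, P.homMk (cokernel.π f.hom),
      by ext; simp, h⟩

include hP in
lemma IsNTiltingTorsionClass.isDeflation_iff {X Y : P.FullSubcategory}
    (f : X ⟶ Y) : IsDeflation (inducedExactStructure P) f ↔ Epi f.hom ∧ P (kernel f.hom) := by
  constructor
  · rintro ⟨Z, i, w, h⟩
    exact ⟨h.epi_g, hP.prop_of_iso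
      (IsLimit.conePointUniqueUpToIso h.fIsKernel (limit.isLimit _)) Z.2⟩
  · rintro ⟨_, hf⟩
    have h : (ShortComplex.mk (kernel.ι f.hom) f.hom (by simp)).ShortExact :=
      { exact := ShortComplex.exact_kernel _ }
    exact ⟨⟨kernel f.hom, hf⟩, P.homMk (kernel.ι f.hom), by ext; simp, h⟩

lemma isKernelCokernelPair_of_inducedExactStructure (S : ShortComplex P.FullSubcategory)
    (hS : inducedExactStructure P S) : IsKernelCokernelPair S := by
  have : Mono S.f.hom := hS.mono_f
  have : Epi S.g.hom := hS.epi_g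
  have : Mono S.f := P.ι.mono_of_mono_map (by assumption)
  have : Epi S.g := P.ι.epi_of_epi_map (by assumption)
  refine ⟨⟨KernelFork.IsLimit.ofι' _ _ fun {W} k hk ↦ ?_⟩,
    ⟨CokernelCofork.IsColimit.ofπ' _ _ fun {W} k hk ↦ ?_⟩⟩
  · obtain ⟨l, hl⟩ := KernelFork.IsLimit.lift' hS.fIsKernel k.hom
      (P.ι.congr_map hk)
    exact ⟨P.homMk l, by ext; exact hl⟩
  · obtain ⟨l, hl⟩ := CokernelCofork.IsColimit.desc' hS.gIsCokernel k.hom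
      (P.ι.congr_map hk)
    exact ⟨P.homMk l, by ext; exact hl⟩

include hP in
-- As `f` is epi, the kernel of the composition is an extension of `kernel g` by `kernel f`.
lemma IsNTiltingTorsionClass.prop_kernel_comp {X Y Z : A} (f : X ⟶ Y) (g : Y ⟶ Z) [Epi f]
    (h₁ : P (kernel f)) (h₂ : P (kernel g)) : P (kernel (f ≫ g)) := by
  let q : kernel (f ≫ g) ⟶ kernel g := kernel.lift _ (kernel.ι _ ≫ f) (by simp)
  have sq : IsPullback (kernel.ι (f ≫ g)) q f (kernel.ι g) := by
    refine IsPullback.of_isLimit' ⟨by simp [q]⟩ (PullbackCone.IsLimit.mk _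
      (fun s ↦ kernel.lift _ s.fst (by simp [s.condition_assoc])) (by simp) ?_ ?_)
    · intro s
      simp [← cancel_mono (kernel.ι g), q, s.condition]
    · intro s m hm _
      simp [← cancel_mono (kernel.ι (f ≫ g)), hm]
  have : Epi q := (MorphismProperty.epimorphisms A).of_isPullback sq ‹Epi f›
  have := isIso_kernel_map_of_isPullback sq.flip
  exact hP.prop_of_prop_kernel q (hP.prop_of_iso (asIso (kernel.map _ _ _ _ sq.flip.w)).symm h₁) h₂

include hP in
lemma IsNTiltingTorsionClass.exists_isPushout {X Y X' : P.FullSubcategory} (i : X ⟶ Y)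
    (f : X ⟶ X') [Mono i.hom] (hi : P (cokernel i.hom)) :
    ∃ (Y' : P.FullSubcategory) (g : Y ⟶ Y') (j : X' ⟶ Y'), IsPushout i f g j ∧ Mono j.hom := by
  have sq := IsPushout.of_hasPushout i.hom f.hom
  have := isIso_cokernel_map_of_isPushout sq
  have hY' : P (pushout i.hom f.hom) := hP.prop_of_prop_cokernel (pushout.inr i.hom f.hom) X'.2
    (hP.prop_of_iso (asIso (cokernel.map _ _ _ _ sq.w)) hi)
  exact ⟨⟨_, hY'⟩, P.homMk (pushout.inl _ _), P.homMk (pushout.inr _ _),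
    IsPushout.of_map_of_faithful P.ι sq, inferInstanceAs (Mono (pushout.inr i.hom f.hom))⟩

include hP in
lemma IsNTiltingTorsionClass.exists_isPullback {Y Z Z' : P.FullSubcategory} (p : Y ⟶ Z)
    (f : Z' ⟶ Z) (hp : IsDeflation (inducedExactStructure P) p) :
    ∃ (Y' : P.FullSubcategory) (g : Y' ⟶ Y) (q : Y' ⟶ Z'), IsPullback g q p f ∧
      IsDeflation (inducedExactStructure P) q := by
  simp only [hP.isDeflation_iff] at hp ⊢
  obtain ⟨_, hp⟩ := hp
  have sq := IsPullback.of_hasPullback p.hom f.hom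
  have := isIso_kernel_map_of_isPullback sq.flip
  have h : P (kernel (pullback.snd p.hom f.hom)) :=
    hP.prop_of_iso (asIso (kernel.map _ _ _ _ sq.flip.w)).symm hp
  exact ⟨⟨_, hP.prop_of_prop_kernel _ h Z'.2⟩, P.homMk (pullback.fst _ _),
    P.homMk (pullback.snd _ _), IsPullback.of_map_of_faithful P.ι sq,
    inferInstanceAs (Epi (pullback.snd p.hom f.hom)), h⟩

include hP in
lemma IsNTiltingTorsionClass.isQuillenExact (hn : 1 ≤ n) :
    IsQuillenExact (inducedExactStructure P) where
  closedUnderIso := ⟨fun e h ↦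
    ShortComplex.shortExact_of_iso (P.ι.mapShortComplex.mapIso e) h⟩
  kernelCokernelPair := isKernelCokernelPair_of_inducedExactStructure
  deflation_id_zero Z _ := by
    rw [hP.isDeflation_iff]
    exact ⟨inferInstanceAs (Epi (𝟙 Z.obj)),
      hP.prop_of_isZero (isZero_kernel_of_mono (𝟙 Z.obj))⟩
  deflation_comp f g := by
    simp only [hP.isDeflation_iff]
    rintro ⟨_, hf⟩ ⟨_, hg⟩
    exact ⟨inferInstanceAs (Epi (f.hom ≫ g.hom)), hP.prop_kernel_comp _ _ hf hg⟩
  inflation_comp f g := by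
    simp only [hP.isInflation_iff hn]
    intro _ _
    exact inferInstanceAs (Mono (f.hom ≫ g.hom))
  pushout {X Y X'} i f := by
    simp only [hP.isInflation_iff hn]
    intro _
    exact hP.exists_isPushout i f (hP.prop_cokernel hn _ X.2 Y.2)
  pullback := hP.exists_isPullback

include hP in
lemma IsNTiltingTorsionClass.isProjectivelyComplete :
    IsProjectivelyComplete P.FullSubcategory where
  hasZeroObject := hP.hasZeroObject
  hasBinaryBiproducts := hP.hasBinaryBiproducts
  isIdempotentComplete := ⟨fun X e he ↦ by
    have he : e.hom ≫ e.hom = e.hom := P.ι.congr_map he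
    have h : image.ι e.hom ≫ factorThruImage e.hom = 𝟙 _ := by
      rw [← cancel_mono (image.ι e.hom), ← cancel_epi (factorThruImage e.hom)]
      simp [he]
    exact ⟨⟨_, hP.prop_of_retract X.2 _ _ h⟩, P.homMk (image.ι e.hom),
      P.homMk (factorThruImage e.hom), P.ι.map_injective h, P.ι.map_injective (image.fac _)⟩⟩

include hP in
-- Exactness means that `cokernel f ⟶ C` is mono. One direction tests the `D`-cokernel on an
-- embedding of `cokernel f` in `E`; the other pushes out along this mono and embeds the pushout in
-- `E`.
lemma IsNTiltingTorsionClass.isDCokernel_iff (hn : 1 ≤ n) {X Y C : P.FullSubcategory}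
    (f : X ⟶ Y) (p : Y ⟶ C) :
    IsDCokernel (inducedExactStructure P) f p ↔
      ∃ w : f.hom ≫ p.hom = 0, (ShortComplex.mk f.hom p.hom w).Exact := by
  constructor
  · rintro ⟨w, h⟩
    replace w : f.hom ≫ p.hom = 0 := P.ι.congr_map w
    refine ⟨w, ?_⟩
    rw [ShortComplex.exact_iff_mono_cokernel_desc]
    obtain ⟨W, i, hW, _⟩ := hP.cogenerates (cokernel f.hom)
    obtain ⟨N, ι, k, hι, fac⟩ := h ⟨W, hW⟩ (P.homMk (cokernel.π f.hom ≫ i)) (by ext; simp)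
    rw [hP.isInflation_iff hn] at hι
    replace fac := P.ι.congr_map fac
    have : cokernel.desc f.hom p.hom w ≫ k.hom = i ≫ ι.hom := by
      ext
      simpa using fac.symm
    have : Mono (cokernel.desc f.hom p.hom w ≫ k.hom) := by
      rw [this]
      infer_instance
    exact mono_of_mono _ k.hom
  · rintro ⟨w, h⟩
    refine ⟨by ext; exact w, fun W j hj ↦ ?_⟩
    replace hj : f.hom ≫ j.hom = 0 := P.ι.congr_map hj
    rw [ShortComplex.exact_iff_mono_cokernel_desc] at h
    dsimp at h
    let a := cokernel.desc f.hom p.hom w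
    let b := cokernel.desc f.hom j.hom hj
    obtain ⟨N, i, hN, _⟩ := hP.cogenerates (pushout a b)
    refine ⟨⟨N, hN⟩, P.homMk (pushout.inr a b ≫ i), P.homMk (pushout.inl a b ≫ i), ?_, ?_⟩
    · rw [hP.isInflation_iff hn]
      dsimp
      infer_instance
    · ext
      have := cokernel.π f.hom ≫= (pushout.condition (f := a) (g := b)) =≫ i
      simpa [a, b] using this.symm

include hP in
lemma IsNTiltingTorsionClass.hasDCokernels (hn : 1 ≤ n) :
    HasDCokernels (inducedExactStructure P) := by
  intro X Y f
  obtain ⟨W, i, hW, _⟩ := hP.cogenerates (cokernel f.hom)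
  refine ⟨⟨W, hW⟩, P.homMk (cokernel.π f.hom ≫ i), ?_⟩
  rw [hP.isDCokernel_iff hn]
  refine ⟨by simp, ?_⟩
  rw [ShortComplex.exact_iff_mono_cokernel_desc]
  convert (inferInstance : Mono i)
  ext
  simp

include hP in
lemma IsNTiltingTorsionClass.exact_map_iff_isDCokernelSequence (hn : 1 ≤ n) {m : ℕ}
    (S : ComposableArrows P.FullSubcategory m) :
    ((P.ι.mapComposableArrows m).obj S).Exact ↔
      IsDCokernelSequence (inducedExactStructure P) S := by
  simp only [IsDCokernelSequence, hP.isDCokernel_iff hn]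
  constructor
  · intro hS i hi
    exact ⟨hS.zero i, hS.exact i⟩
  · intro hS
    exact { zero := fun i hi ↦ (hS i hi).choose
            exact := fun i hi ↦ (hS i hi).choose_spec }

lemma hasCokernel_of_prop_cokernel {X Y : P.FullSubcategory} (f : X ⟶ Y)
    (h : P (cokernel f.hom)) : HasCokernel f := by
  have : Epi (P.homMk (cokernel.π f.hom) : Y ⟶ ⟨_, h⟩) :=
    P.ι.epi_of_epi_map (inferInstanceAs (Epi (cokernel.π f.hom)))
  exact ⟨⟨_, CokernelCofork.IsColimit.ofπ' (P.homMk (cokernel.π f.hom) : Y ⟶ ⟨_, h⟩)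
    (by ext; simp) (fun k hk ↦ ⟨P.homMk (cokernel.desc f.hom k.hom (P.ι.congr_map hk)),
      by ext; simp⟩)⟩⟩

/-- The first cokernel has order 2 and each exact spot adds one, so the last cokernel of a sequence
of `n` objects has order `n`. -/
lemma isCosyzygy_cokernel_of_exact {m : ℕ} (S : ComposableArrows P.FullSubcategory (m + 1))
    (hS : ((P.ι.mapComposableArrows (m + 1)).obj S).Exact) (i : ℕ) (hi : i ≤ m) :
    IsCosyzygy P (i + 2) (cokernel (S.map' i (i + 1)).hom) := by
  induction i with
  | zero => exact isCosyzygy_cokernel _ (S.obj _).2 (S.obj _).2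
  | succ i h => exact .cokernel_of_exact (hS.exact i) (S.obj _).2 (h (by omega))

include hP in
lemma IsNTiltingTorsionClass.hasCokernel_of_exact {m : ℕ} (hm : n = m + 2)
    (S : ComposableArrows P.FullSubcategory (m + 1))
    (hS : ((P.ι.mapComposableArrows (m + 1)).obj S).Exact) :
    HasCokernel (S.map' m (m + 1)) := by
  subst hm
  exact hasCokernel_of_prop_cokernel _
    (hP.prop_of_isCosyzygy (isCosyzygy_cokernel_of_exact S hS m (by omega)))

end InducedExactStructure

/-! ### The case `n = 1` -/

section QuasiAbelian

variable {A : Type u} [Category.{v} A] [Abelian A] {P : ObjectProperty A}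

lemma nonempty_normalMono_of_isInflation {n : ℕ} (hP : IsNTiltingTorsionClass n P) (hn : 1 ≤ n)
    {X Y : P.FullSubcategory} (f : X ⟶ Y) [Mono f.hom] : Nonempty (NormalMono f) := by
  obtain ⟨Z, p, w, h⟩ := (hP.isInflation_iff hn f).2 inferInstance
  obtain ⟨⟨hf⟩, _⟩ := isKernelCokernelPair_of_inducedExactStructure _ h
  exact ⟨⟨Z, p, w, hf⟩⟩

lemma nonempty_normalEpi_of_isDeflation {X Y : P.FullSubcategory} (f : X ⟶ Y)
    (hf : IsDeflation (inducedExactStructure P) f) : Nonempty (NormalEpi f) := by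
  obtain ⟨Z, i, w, h⟩ := hf
  obtain ⟨_, ⟨hf⟩⟩ := isKernelCokernelPair_of_inducedExactStructure _ h
  exact ⟨⟨Z, i, w, hf⟩⟩

variable (hP : IsNTiltingTorsionClass 1 P)

include hP

lemma IsNTiltingTorsionClass.prop_of_epi {X Y : A} (p : X ⟶ Y) [Epi p] (hX : P X) : P Y :=
  hP.prop_of_isCosyzygy (isCosyzygy_succ_of_epi p hX trivial)

/-- The image of a `D`-kernel is a quotient of an object of `E`, hence in `E`. Factorizations known
only after a deflation descend, by lifting this epi against the image inclusion. -/
lemma IsNTiltingTorsionClass.exists_kernel {X Y : P.FullSubcategory} (f : X ⟶ Y) :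
    ∃ (T : P.FullSubcategory) (t : T ⟶ X), Mono t.hom ∧ t ≫ f = 0 ∧
      ∀ ⦃W : P.FullSubcategory⦄ (k : W ⟶ X), k ≫ f = 0 → ∃ l, l ≫ t = k := by
  obtain ⟨K, i, w, h⟩ := hP.hasDKernels _ _ f
  refine ⟨⟨image i.hom, hP.prop_of_epi (factorThruImage i.hom) K.2⟩, P.homMk (image.ι i.hom),
    inferInstanceAs (Mono (image.ι i.hom)), ?_, fun W k hk ↦ ?_⟩
  · ext
    simpa using P.ι.congr_map w
  · obtain ⟨N, π, l, hπ, fac⟩ := h W k hk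
    have : Epi π.hom := (hP.isDeflation_iff π).1 hπ |>.1
    have := strongEpi_of_epi π.hom
    have := StrongEpi.llp (f := π.hom) (image.ι i.hom)
    have sq : CommSq (l.hom ≫ factorThruImage i.hom) π.hom (image.ι i.hom) k.hom :=
      ⟨by simpa using (P.ι.congr_map fac).symm⟩
    exact ⟨P.homMk sq.lift, by ext; simp⟩

lemma IsNTiltingTorsionClass.hasKernels : HasKernels P.FullSubcategory where
  has_limit f := by
    obtain ⟨T, t, _, w, h⟩ := hP.exists_kernel f
    have : Mono t := P.ι.mono_of_mono_map (by assumption)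
    exact ⟨⟨_, KernelFork.IsLimit.ofι' t w (fun k hk ↦ ⟨_, (h k hk).choose_spec⟩)⟩⟩

lemma IsNTiltingTorsionClass.hasCokernels : HasCokernels P.FullSubcategory where
  has_colimit {_ Y} f := hasCokernel_of_prop_cokernel f (hP.prop_of_epi (cokernel.π f.hom) Y.2)

/-- By comparison with the kernel of `exists_kernel`, which is mono in `A`: `i` is the composition
of a split mono with it. -/
lemma IsNTiltingTorsionClass.mono_hom_of_normalMono {X Y : P.FullSubcategory} {i : X ⟶ Y}
    (hi : NormalMono i) : Mono i.hom := by
  have : Mono i := mono_of_isLimit_fork hi.isLimit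
  obtain ⟨T, t, _, w, h⟩ := hP.exists_kernel hi.g
  obtain ⟨l, hl⟩ := h i hi.w
  obtain ⟨l', hl'⟩ := KernelFork.IsLimit.lift' hi.isLimit t w
  dsimp at hl'
  have hll' : l ≫ l' = 𝟙 _ := by rw [← cancel_mono i, Category.assoc, hl', hl, Category.id_comp]
  have : Mono l.hom := (IsSplitMono.mk' ⟨l'.hom, P.ι.congr_map hll'⟩).mono
  rw [← hl]
  exact inferInstanceAs (Mono (l.hom ≫ t.hom))

/-- The cokernel of `hp.g` in `A` is a quotient of `Y`, so it is also the cokernel in `E`. Its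
kernel is the image of `hp.g`, again a quotient of an object of `E`. -/
lemma IsNTiltingTorsionClass.isDeflation_of_normalEpi {Y Z : P.FullSubcategory} {p : Y ⟶ Z}
    (hp : NormalEpi p) : IsDeflation (inducedExactStructure P) p := by
  have : Epi p := epi_of_isColimit_cofork hp.isColimit
  let c : Y ⟶ (⟨cokernel hp.g.hom, hP.prop_of_epi (cokernel.π hp.g.hom) Y.2⟩ :
    P.FullSubcategory) := P.homMk (cokernel.π hp.g.hom)
  have hc : Epi c.hom := inferInstanceAs (Epi (cokernel.π hp.g.hom))
  have : Epi c := P.ι.epi_of_epi_map hc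
  obtain ⟨l, hl⟩ := CokernelCofork.IsColimit.desc' hp.isColimit c (by ext; simp [c])
  dsimp at hl
  let l' : (⟨cokernel hp.g.hom, hP.prop_of_epi (cokernel.π hp.g.hom) Y.2⟩ :
    P.FullSubcategory) ⟶ Z := P.homMk (cokernel.desc _ p.hom (P.ι.congr_map hp.w))
  have hl' : c ≫ l' = p := by ext; simp [c, l']
  have : IsIso l' := ⟨l, by rw [← cancel_epi c, reassoc_of% hl', hl, Category.comp_id],
    by rw [← cancel_epi p, reassoc_of% hl, hl', Category.comp_id]⟩
  have hk : P (kernel c.hom) :=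
    hP.prop_of_epi (Abelian.factorThruImage hp.g.hom) hp.W.2
  rw [hP.isDeflation_iff, ← hl']
  exact ⟨inferInstanceAs (Epi (c.hom ≫ l'.hom)),
    hP.prop_kernel_comp _ _ hk (hP.prop_of_isZero (isZero_kernel_of_mono _))⟩

lemma IsNTiltingTorsionClass.inducedExactStructure_iff (S : ShortComplex P.FullSubcategory) :
    inducedExactStructure P S ↔ IsKernelCokernelPair S := by
  refine ⟨isKernelCokernelPair_of_inducedExactStructure S, ?_⟩
  rintro ⟨⟨hf⟩, ⟨hg⟩⟩
  have hf' : Mono S.f.hom := hP.mono_hom_of_normalMono ⟨_, _, _, hf⟩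
  have hg' : IsDeflation (inducedExactStructure P) S.g :=
    hP.isDeflation_of_normalEpi ⟨_, _, _, hg⟩
  obtain ⟨hg', hk⟩ := (hP.isDeflation_iff _).1 hg'
  obtain ⟨l, hl⟩ := KernelFork.IsLimit.lift' hf
    (P.homMk (kernel.ι S.g.hom) : ⟨kernel S.g.hom, hk⟩ ⟶ S.X₂) (by ext; simp)
  have : l.hom ≫ S.f.hom = kernel.ι S.g.hom := P.ι.congr_map hl
  have h : IsLimit (KernelFork.ofι (S.map P.ι).f (S.map P.ι).zero) :=
    KernelFork.IsLimit.ofι' (hi := hf') _ _ (fun k hk ↦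
      ⟨kernel.lift S.g.hom k hk ≫ l.hom, (Category.assoc _ _ _).trans
        ((congr_arg _ this).trans (kernel.lift_ι _ _ _))⟩)
  exact { exact := ShortComplex.exact_of_f_is_kernel _ h
          mono_f := hf'
          epi_g := hg' }

lemma IsNTiltingTorsionClass.nQuasiAbelianCondition_one :
    NQuasiAbelianCondition (inducedExactStructure P) 1 := by
  refine ⟨⟨hP.hasKernels, hP.hasCokernels⟩, ?_, ?_, hP.inducedExactStructure_iff⟩
  · rintro X Y X' Y' i f g j sq ⟨hi⟩
    have := hP.mono_hom_of_normalMono hi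
    obtain ⟨Y'', g', j', sq', _⟩ := hP.exists_isPushout i f (hP.prop_cokernel le_rfl _ X.2 Y.2)
    have : Mono j.hom := by
      rw [← sq'.inr_isoIsPushout_hom _ _ sq]
      exact inferInstanceAs (Mono (j'.hom ≫ InducedCategory.Hom.hom _))
    exact nonempty_normalMono_of_isInflation hP le_rfl j
  · rintro Y Z Y' Z' p f g q sq ⟨hp⟩
    obtain ⟨Y'', g', q', sq', hq'⟩ := hP.exists_isPullback p f (hP.isDeflation_of_normalEpi hp)
    apply nonempty_normalEpi_of_isDeflation
    rw [hP.isDeflation_iff] at hq' ⊢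
    obtain ⟨_, hq'⟩ := hq'
    rw [← sq.isoIsPullback_hom_snd _ _ sq']
    exact ⟨inferInstanceAs (Epi (InducedCategory.Hom.hom _ ≫ q'.hom)), hP.prop_kernel_comp _ _
      (hP.prop_of_isZero (isZero_kernel_of_mono _)) hq'⟩

end QuasiAbelian

/-! ### Acyclic complexes are the exact ones -/

section Acyclic

variable {A : Type u} [Category.{v} A] [Abelian A] {n : ℕ} {P : ObjectProperty A}

lemma shortExact_fromOpcycles_pOpcycles (L : CochainComplex A ℤ) (i j : ℤ) (hij : i + 1 = j)
    (hL : L.ExactAt i) :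
    (ShortComplex.mk (L.fromOpcycles i j) (L.pOpcycles j)
      (by rw [← cancel_epi (L.pOpcycles i)]; simp)).ShortExact := by
  let φ : ShortComplex.mk (L.d i j) (L.pOpcycles j) (by simp) ⟶
    ShortComplex.mk (L.fromOpcycles i j) (L.pOpcycles j)
      (by rw [← cancel_epi (L.pOpcycles i)]; simp) :=
    { τ₁ := L.pOpcycles i, τ₂ := 𝟙 _, τ₃ := 𝟙 _ }
  have : Epi φ.τ₁ := inferInstanceAs (Epi (L.pOpcycles i))
  have : IsIso φ.τ₂ := by dsimp [φ]; infer_instance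
  have : Mono φ.τ₃ := by dsimp [φ]; infer_instance
  have : Mono (L.fromOpcycles i j) := by
    obtain rfl : (ComplexShape.up ℤ).next i = j := by simp [hij]
    exact ShortComplex.Exact.mono_fromOpcycles hL
  exact
    { exact := (ShortComplex.exact_iff_of_epi_of_isIso_of_mono φ).1
        (ShortComplex.exact_of_g_is_cokernel _ (L.opcyclesIsCokernel i j (by simp [← hij])))
      mono_f := this
      epi_g := inferInstanceAs (Epi (L.pOpcycles j)) }

/-- Each opcycles object is the quotient of `L.X i` by the preceding one; since the complex is exact
arbitrarily far to the left, every order is reached. -/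
lemma isCosyzygy_opcycles (L : CochainComplex A ℤ) (hL : ∀ i, P (L.X i)) (m : ℤ)
    (hm : ∀ i < m, L.ExactAt i) (r : ℕ) : ∀ i ≤ m, IsCosyzygy P r (L.opcycles i) := by
  induction r with
  | zero => intros; trivial
  | succ r hr =>
    intro i hi
    exact .of_shortExact
      (shortExact_fromOpcycles_pOpcycles L (i - 1) i (by simp) (hm _ (by lia)))
      (hr _ (by lia)) (hL i)

lemma IsNTiltingTorsionClass.prop_opcycles (hP : IsNTiltingTorsionClass n P)
    (L : CochainComplex A ℤ) (hL : ∀ i, P (L.X i)) (m : ℤ)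
    (hm : ∀ i < m, L.ExactAt i) (i : ℤ) (hi : i ≤ m) : P (L.opcycles i) :=
  hP.prop_of_isCosyzygy (isCosyzygy_opcycles L hL m hm n i hi)

lemma IsAcyclic.exactAt {K : CochainComplex P.FullSubcategory ℤ}
    (hK : IsAcyclic (inducedExactStructure P) K) (i : ℤ) :
    ((P.ι.mapHomologicalComplex _).obj K).ExactAt i := by
  obtain ⟨j, rfl⟩ : ∃ j, i = j + 1 + 1 := ⟨i - 1 - 1, by simp⟩
  rw [HomologicalComplex.exactAt_iff' _ (j + 1) (j + 1 + 1) (j + 1 + 1 + 1) (by simp) (by simp)]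
  obtain ⟨Z, e, m, fac, h⟩ := hK
  obtain ⟨w, hw⟩ := h (j + 1)
  let φ : ((P.ι.mapHomologicalComplex (.up ℤ)).obj K).sc' (j + 1) (j + 1 + 1) (j + 1 + 1 + 1) ⟶
      (ShortComplex.mk (m (j + 1)) (K.d (j + 1 + 1) (j + 1 + 1 + 1)) (by
        rw [← fac (j + 1 + 1), reassoc_of% w, zero_comp])).map P.ι :=
    { τ₁ := (e (j + 1)).hom
      τ₂ := 𝟙 _
      τ₃ := 𝟙 _
      comm₁₂ := (P.ι.congr_map (fac (j + 1))).trans (Category.comp_id _).symm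
      comm₂₃ := (Category.id_comp _).trans (Category.comp_id _).symm }
  let ψ : (ShortComplex.mk (m (j + 1)) (e (j + 1 + 1)) w).map P.ι ⟶
      (ShortComplex.mk (m (j + 1)) (K.d (j + 1 + 1) (j + 1 + 1 + 1)) (by
        rw [← fac (j + 1 + 1), reassoc_of% w, zero_comp])).map P.ι :=
    { τ₁ := 𝟙 _
      τ₂ := 𝟙 _
      τ₃ := (m (j + 1 + 1)).hom
      comm₁₂ := (Category.id_comp _).trans (Category.comp_id _).symm
      comm₂₃ := (Category.id_comp _).trans (P.ι.congr_map (fac (j + 1 + 1))).symm }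
  have : Epi φ.τ₁ := (h j).choose_spec.epi_g
  have : IsIso φ.τ₂ := inferInstanceAs (IsIso (𝟙 (K.X (j + 1 + 1)).obj))
  have : Mono φ.τ₃ := inferInstanceAs (Mono (𝟙 (K.X (j + 1 + 1 + 1)).obj))
  have : Epi ψ.τ₁ := inferInstanceAs (Epi (𝟙 (Z (j + 1)).obj))
  have : IsIso ψ.τ₂ := inferInstanceAs (IsIso (𝟙 (K.X (j + 1 + 1)).obj))
  have : Mono ψ.τ₃ := (h (j + 1 + 1)).choose_spec.mono_f
  rw [ShortComplex.exact_iff_of_epi_of_isIso_of_mono φ,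
    ← ShortComplex.exact_iff_of_epi_of_isIso_of_mono ψ]
  exact hw.exact

lemma IsNTiltingTorsionClass.isAcyclic_iff (hP : IsNTiltingTorsionClass n P)
    (K : CochainComplex P.FullSubcategory ℤ) :
    IsAcyclic (inducedExactStructure P) K ↔ ((P.ι.mapHomologicalComplex _).obj K).Acyclic := by
  refine ⟨fun hK ↦ hK.exactAt, fun hK ↦ ?_⟩
  let L := (P.ι.mapHomologicalComplex (.up ℤ)).obj K
  -- Opcycles, rather than cycles, serve as the objects `Z i`, since they are visibly cosyzygies.
  have hZ (i : ℤ) : P (L.opcycles i) :=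
    hP.prop_opcycles L (fun i ↦ (K.X i).2) i (fun i _ ↦ hK i) i le_rfl
  refine ⟨fun i ↦ ⟨_, hZ i⟩, fun i ↦ P.homMk (L.pOpcycles i),
    fun i ↦ P.homMk (L.fromOpcycles i (i + 1)), fun i ↦ ?_, fun i ↦ ?_⟩
  · ext
    exact L.p_fromOpcycles i (i + 1)
  · have h := shortExact_fromOpcycles_pOpcycles L i (i + 1) rfl (hK i)
    have w : L.fromOpcycles i (i + 1) ≫ L.pOpcycles (i + 1) = 0 := by
      rw [← cancel_epi (L.pOpcycles i)]
      simp
    exact ⟨P.ι.map_injective w, h⟩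

lemma IsNTiltingTorsionClass.acyclicComplexes_eq (hP : IsNTiltingTorsionClass n P) :
    acyclicComplexes (inducedExactStructure P) =
      (HomotopyCategory.subcategoryAcyclic A).inverseImage
        (P.ι.mapHomotopyCategory (ComplexShape.up ℤ)) := by
  ext X
  constructor
  · rintro ⟨K, hK, ⟨e⟩⟩
    refine ObjectProperty.prop_of_iso _ e.symm ?_
    rw [hP.isAcyclic_iff] at hK
    exact (HomotopyCategory.quotient_obj_mem_subcategoryAcyclic_iff_acyclic _).2 hK
  · obtain ⟨K, rfl⟩ := HomotopyCategory.quotient_obj_surjective X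
    intro hK
    exact ⟨K, (hP.isAcyclic_iff K).2
      ((HomotopyCategory.quotient_obj_mem_subcategoryAcyclic_iff_acyclic _).1 hK),
      ⟨Iso.refl _⟩⟩

variable [HasZeroObject P.FullSubcategory] [HasBinaryBiproducts P.FullSubcategory]

lemma IsNTiltingTorsionClass.isTriangulated_acyclicComplexes
    (hP : IsNTiltingTorsionClass n P) :
    (acyclicComplexes (inducedExactStructure P)).IsTriangulated := by
  rw [hP.acyclicComplexes_eq]
  infer_instance

lemma IsNTiltingTorsionClass.trW_acyclicComplexes_iff [HasDerivedCategory.{w} A]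
    (hP : IsNTiltingTorsionClass n P)
    {X Y : HomotopyCategory P.FullSubcategory (ComplexShape.up ℤ)} (f : X ⟶ Y) :
    (acyclicComplexes (inducedExactStructure P)).trW f ↔
      IsIso (DerivedCategory.Qh.map ((P.ι.mapHomotopyCategory (ComplexShape.up ℤ)).map f)) := by
  rw [hP.acyclicComplexes_eq, ObjectProperty.inverseImage_trW_iff,
    DerivedCategory.isIso_Qh_map_iff, HomotopyCategory.quasiIso_eq_trW_subcategoryAcyclic]

end Acyclic

/-! ### Resolving complexes of `A` by complexes over `E` -/

section Resolution

open Pretriangulated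

variable {A : Type u} [Category.{v} A] [Abelian A] {n : ℕ} {P : ObjectProperty A}
  (hP : IsNTiltingTorsionClass n P)

include hP

/-- Termwise embeddings `ι j` need not commute with differentials, so the target is the contractible
complex with terms `E j ⊞ E (j + 1)`, with second component `d ≫ ι (j + 1)`. -/
lemma IsNTiltingTorsionClass.exists_mono_complex (K : CochainComplex A ℤ) :
    ∃ (V : CochainComplex A ℤ) (i : K ⟶ V), (∀ j, P (V.X j)) ∧ ∀ j, Mono (i.f j) := by
  choose E ι hE hι using fun j ↦ hP.cogenerates (K.X j)
  let d (j : ℤ) : E j ⊞ E (j + 1) ⟶ E (j + 1) ⊞ E (j + 1 + 1) := biprod.snd ≫ biprod.inl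
  refine ⟨CochainComplex.of (fun j ↦ E j ⊞ E (j + 1)) d (by simp [d]), CochainComplex.ofHom
      (fun j ↦ biprod.lift (ι j) (K.d j (j + 1) ≫ ι (j + 1))) (fun j ↦ ?_),
    fun j ↦ hP.prop_biprod (hE _) (hE _), fun j ↦ ?_⟩
  · change _ ≫ CochainComplex.of.d (fun j ↦ E j ⊞ E (j + 1)) d j (j + 1) = _
    rw [CochainComplex.of_d]
    ext <;> simp [d]
  · have : Mono (biprod.lift (ι j) (K.d j (j + 1) ≫ ι (j + 1)) ≫ biprod.fst) := by
      rw [biprod.lift_fst]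
      exact hι j
    exact mono_of_mono _ biprod.fst

variable [HasZeroObject P.FullSubcategory] [HasBinaryBiproducts P.FullSubcategory]
  [HasDerivedCategory.{w} A]

/-- Any complex in `A` is quasi-isomorphic to a complex with entries in a `n`-tilting torsion
class. -/
lemma IsNTiltingTorsionClass.exists_resolution (X : HomotopyCategory A (ComplexShape.up ℤ)) :
    ∃ (L : HomotopyCategory P.FullSubcategory (ComplexShape.up ℤ))
      (t : X ⟶ (P.ι.mapHomotopyCategory (ComplexShape.up ℤ)).obj L),
      IsIso (DerivedCategory.Qh.map t) := by
  obtain ⟨K, rfl⟩ := HomotopyCategory.quotient_obj_surjective X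
  -- Each embedding in a complex over `E` raises by one the order of the terms of the quotient, and
  -- at order `n` these terms lie in `E`.
  suffices ∀ (k r : ℕ) (_ : k + r = n) (K : CochainComplex A ℤ)
      (_ : ∀ i, IsCosyzygy P r (K.X i)),
      ∃ (L : HomotopyCategory P.FullSubcategory (ComplexShape.up ℤ))
        (t : (HomotopyCategory.quotient _ _).obj K ⟶
          (P.ι.mapHomotopyCategory (ComplexShape.up ℤ)).obj L),
        IsIso (DerivedCategory.Qh.map t) from
    this n 0 (by simp) K (fun _ ↦ trivial)
  intro k
  induction k with
  | zero =>
    rintro r hr K hK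
    obtain rfl : r = n := by omega
    exact ⟨(HomotopyCategory.quotient _ _).obj
      (K.liftObjectProperty P (fun i ↦ hP.prop_of_isCosyzygy (hK i))), 𝟙 _,
      inferInstanceAs (IsIso (DerivedCategory.Qh.map
        (𝟙 ((HomotopyCategory.quotient A (ComplexShape.up ℤ)).obj K))))⟩
  | succ k hk =>
    rintro r hr K hK
    obtain ⟨V, i, hV, hi⟩ := hP.exists_mono_complex K
    have : Mono i := HomologicalComplex.mono_of_mono_f i hi
    let S := ShortComplex.mk i (cokernel.π i) (by simp)
    have hS : S.ShortExact := { exact := ShortComplex.exact_cokernel i }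
    obtain ⟨L₁, t₁, ht₁⟩ := hk (r + 1) (by omega) S.X₃ (fun j ↦
      .of_shortExact (hS.map_of_exact (HomologicalComplex.eval _ _ j)) (hK j) (hV j))
    have := CochainComplex.mappingCone.quasiIso_descShortComplex hS
    let F := P.ι.mapHomotopyCategory (ComplexShape.up ℤ)
    let V' : HomotopyCategory P.FullSubcategory (ComplexShape.up ℤ) :=
      (HomotopyCategory.quotient _ _).obj (V.liftObjectProperty P hV)
    let c : (HomotopyCategory.quotient _ _).obj (CochainComplex.mappingCone S.f) ⟶ F.obj L₁ :=
      (HomotopyCategory.quotient _ _).map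
        (CochainComplex.mappingCone.descShortComplex S) ≫ t₁
    have hc : IsIso (DerivedCategory.Qh.map c) := by
      have : IsIso (DerivedCategory.Qh.map ((HomotopyCategory.quotient A _).map
        (CochainComplex.mappingCone.descShortComplex S))) := by
        rw [DerivedCategory.isIso_Qh_map_iff, HomotopyCategory.quotient_map_mem_quasiIso_iff,
          HomologicalComplex.mem_quasiIso_iff]
        infer_instance
      dsimp only [c]
      rw [Functor.map_comp]
      infer_instance
    -- The map from `V` to the resolution of the quotient lifts to `K(E)` by fullness; the cocone of
    -- the lift resolves `K`.
    obtain ⟨g, hg⟩ : ∃ g : V' ⟶ L₁, F.map g =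
        (HomotopyCategory.quotient _ _).map (CochainComplex.mappingCone.inr S.f) ≫ c :=
      F.map_surjective _
    obtain ⟨Z, f, h, hT⟩ := distinguished_cocone_triangle₁ g
    have hT₁ : CochainComplex.mappingCone.triangleh S.f ∈ distTriang _ :=
      ⟨_, _, _, ⟨Iso.refl _⟩⟩
    have hT₂ := F.map_distinguished _ hT
    obtain ⟨a, ha, ha'⟩ := complete_distinguished_triangle_morphism₁ _ _ hT₁ hT₂ (𝟙 _) c
      (hg.symm.trans (Category.id_comp _).symm)
    let φ : CochainComplex.mappingCone.triangleh S.f ⟶ F.mapTriangle.obj (Triangle.mk f g h) :=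
      { hom₁ := a, hom₂ := 𝟙 _, hom₃ := c, comm₁ := ha
        comm₂ := hg.symm.trans (Category.id_comp _).symm, comm₃ := ha' }
    exact ⟨Z, a, isIso₁_of_isIso₂₃ (DerivedCategory.Qh.mapTriangle.map φ)
      (DerivedCategory.Qh.map_distinguished _ hT₁) (DerivedCategory.Qh.map_distinguished _ hT₂)
      (inferInstanceAs (IsIso (DerivedCategory.Qh.map
        (𝟙 ((HomotopyCategory.quotient A (ComplexShape.up ℤ)).obj V))))) hc⟩

end Resolution

/-! ### The equivalence with `D(A)` -/

section Comparison

variable {A : Type u} [Category.{v} A] [Abelian A] {n : ℕ} {P : ObjectProperty A}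
  (hP : IsNTiltingTorsionClass n P)
  [HasZeroObject P.FullSubcategory] [HasBinaryBiproducts P.FullSubcategory]
  [(acyclicComplexes (inducedExactStructure P)).IsTriangulated]
  [HasDerivedCategory.{w} A]

/-- The canonical functor `K(E)/N ⥤ D(A)`. -/
def IsNTiltingTorsionClass.comparison :
    ExactDerivedCategory (inducedExactStructure P) ⥤ DerivedCategory A :=
  Localization.lift (P.ι.mapHomotopyCategory (ComplexShape.up ℤ) ⋙ DerivedCategory.Qh)
    (fun _ _ _ hf ↦ hP.trW_acyclicComplexes_iff _ |>.1 hf)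
    (quotientFunctor (inducedExactStructure P))

instance : Localization.Lifting (quotientFunctor (inducedExactStructure P))
    (acyclicComplexes (inducedExactStructure P)).trW
    (P.ι.mapHomotopyCategory (ComplexShape.up ℤ) ⋙ DerivedCategory.Qh) hP.comparison :=
  Localization.liftingLift (W := (acyclicComplexes (inducedExactStructure P)).trW) _
    (fun _ _ _ hf ↦ hP.trW_acyclicComplexes_iff _ |>.1 hf) _

/-- The canonical functor `K(E)/N ⥤ D(A)` is induced by `K(E) ⥤ K(A)`. -/
def IsNTiltingTorsionClass.comparisonFactors :
    quotientFunctor (inducedExactStructure P) ⋙ hP.comparison ≅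
      P.ι.mapHomotopyCategory (ComplexShape.up ℤ) ⋙ DerivedCategory.Qh :=
  Localization.Lifting.iso _ (acyclicComplexes (inducedExactStructure P)).trW _ _

instance : hP.comparison.CommShift ℤ :=
  Functor.commShiftOfLocalization (quotientFunctor (inducedExactStructure P))
    (acyclicComplexes (inducedExactStructure P)).trW ℤ
    (P.ι.mapHomotopyCategory (ComplexShape.up ℤ) ⋙ DerivedCategory.Qh) hP.comparison

instance : NatTrans.CommShift hP.comparisonFactors.hom ℤ :=
  inferInstanceAs (NatTrans.CommShift (Localization.Lifting.iso
    (quotientFunctor (inducedExactStructure P))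
    (acyclicComplexes (inducedExactStructure P)).trW
    (P.ι.mapHomotopyCategory (ComplexShape.up ℤ) ⋙ DerivedCategory.Qh) hP.comparison).hom ℤ)

instance : (quotientFunctor (inducedExactStructure P)).EssSurj :=
  Localization.essSurj _ (acyclicComplexes (inducedExactStructure P)).trW

instance : (quotientFunctor (inducedExactStructure P)).mapArrow.EssSurj :=
  Localization.essSurj_mapArrow _ (acyclicComplexes (inducedExactStructure P)).trW

instance : hP.comparison.IsTriangulated :=
  Functor.isTriangulated_of_precomp_iso hP.comparisonFactors

instance : hP.comparison.Additive := by
  rw [Localization.functor_additive_iff (quotientFunctor (inducedExactStructure P))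
    (acyclicComplexes (inducedExactStructure P)).trW]
  exact Functor.additive_of_iso hP.comparisonFactors.symm

omit [(acyclicComplexes (inducedExactStructure P)).IsTriangulated] in
include hP in
/-- A right roof `F X ⟶ Z ⟵ F Y` in `K(A)` is dominated by a roof in `K(E)`. -/
lemma IsNTiltingTorsionClass.exists_comp_eq_map
    {Y : HomotopyCategory P.FullSubcategory (ComplexShape.up ℤ)}
    {Z : HomotopyCategory A (ComplexShape.up ℤ)}
    (s : (P.ι.mapHomotopyCategory (ComplexShape.up ℤ)).obj Y ⟶ Z)
    [IsIso (DerivedCategory.Qh.map s)] :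
    ∃ (L : HomotopyCategory P.FullSubcategory (ComplexShape.up ℤ))
      (t : Z ⟶ (P.ι.mapHomotopyCategory (ComplexShape.up ℤ)).obj L) (s' : Y ⟶ L),
      s ≫ t = (P.ι.mapHomotopyCategory (ComplexShape.up ℤ)).map s' ∧
      (acyclicComplexes (inducedExactStructure P)).trW s' := by
  obtain ⟨L, t, ht⟩ := hP.exists_resolution Z
  obtain ⟨s', hs'⟩ := (P.ι.mapHomotopyCategory (ComplexShape.up ℤ)).map_surjective (s ≫ t)
  refine ⟨L, t, s', hs'.symm, ?_⟩
  rw [hP.trW_acyclicComplexes_iff, hs', Functor.map_comp]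
  infer_instance

instance : hP.comparison.Faithful := by
  refine Functor.faithful_of_comp_cancel_zero_of_hasLeftCalculusOfFractions
    (quotientFunctor (inducedExactStructure P))
    (acyclicComplexes (inducedExactStructure P)).trW _ (fun X Y f hf ↦ ?_)
  replace hf : DerivedCategory.Qh.map
      ((P.ι.mapHomotopyCategory (ComplexShape.up ℤ)).map f) = DerivedCategory.Qh.map 0 := by
    have := NatIso.naturality_2 hP.comparisonFactors.symm f
    dsimp at this
    rw [← this, hf, zero_comp, comp_zero, Functor.map_zero]
  -- A map that vanishes in `D(A)` is killed by a quasi-isomorphism `s` of `K(A)`; composing with a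
  -- resolution of its target replaces `s` by a morphism of `K(E)`.
  rw [MorphismProperty.map_eq_iff_postcomp DerivedCategory.Qh
    (HomotopyCategory.quasiIso _ _)] at hf
  obtain ⟨Z, s, hs, fac⟩ := hf
  rw [← DerivedCategory.isIso_Qh_map_iff] at hs
  obtain ⟨L, t, s', fac', hs'⟩ := hP.exists_comp_eq_map s
  have := Localization.inverts (quotientFunctor (inducedExactStructure P)) _ s' hs'
  rw [← cancel_mono ((quotientFunctor (inducedExactStructure P)).map s'), zero_comp,
    ← Functor.map_comp]
  have : f ≫ s' = 0 := (P.ι.mapHomotopyCategory (ComplexShape.up ℤ)).map_injective (by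
    rw [Functor.map_comp, ← fac', reassoc_of% fac, zero_comp, Functor.map_zero])
  rw [this, Functor.map_zero]

instance : hP.comparison.Full := by
  refine Functor.full_of_comp_essSurj _ (quotientFunctor (inducedExactStructure P))
    (fun X Y φ ↦ ?_)
  obtain ⟨φ', rfl⟩ : ∃ φ', φ = hP.comparisonFactors.hom.app X ≫ φ' ≫
      hP.comparisonFactors.inv.app Y :=
    ⟨hP.comparisonFactors.inv.app X ≫ φ ≫ hP.comparisonFactors.hom.app Y, by simp⟩
  obtain ⟨ψ, hψ⟩ := Localization.exists_leftFraction DerivedCategory.Qh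
    (HomotopyCategory.quasiIso _ _) φ'
  have hs := ψ.hs
  rw [← DerivedCategory.isIso_Qh_map_iff] at hs
  obtain ⟨L, t, s', fac', hs'⟩ := hP.exists_comp_eq_map ψ.s
  have := Localization.inverts (quotientFunctor (inducedExactStructure P)) _ s' hs'
  obtain ⟨f, hf⟩ := (P.ι.mapHomotopyCategory (ComplexShape.up ℤ)).map_surjective (ψ.f ≫ t)
  refine ⟨(quotientFunctor (inducedExactStructure P)).map f ≫
    inv ((quotientFunctor (inducedExactStructure P)).map s'), ?_⟩
  rw [← cancel_mono (hP.comparison.map ((quotientFunctor (inducedExactStructure P)).map s')),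
    ← Functor.map_comp, Category.assoc, IsIso.inv_hom_id, Category.comp_id]
  have h₁ := NatIso.naturality_2 hP.comparisonFactors f
  have h₂ := NatIso.naturality_2 hP.comparisonFactors s'
  dsimp at h₁ h₂
  have h₃ : φ' ≫ DerivedCategory.Qh.map ψ.s = DerivedCategory.Qh.map ψ.f := by
    rw [hψ]
    exact ψ.map_comp_map_s _ _
  rw [← h₁, ← h₂]
  simp only [Category.assoc, Iso.inv_hom_id_app_assoc]
  rw [hf, ← fac', Functor.map_comp, Functor.map_comp]
  simp only [Category.assoc, reassoc_of% h₃]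

instance : hP.comparison.EssSurj where
  mem_essImage Y := by
    obtain ⟨K, ⟨e⟩⟩ : ∃ K, Nonempty (DerivedCategory.Qh.obj K ≅ Y) :=
      ⟨_, ⟨DerivedCategory.Qh.objObjPreimageIso Y⟩⟩
    obtain ⟨L, t, _⟩ := hP.exists_resolution K
    exact ⟨(quotientFunctor (inducedExactStructure P)).obj L,
      ⟨hP.comparisonFactors.app L ≪≫ (asIso (DerivedCategory.Qh.map t)).symm ≪≫ e⟩⟩

instance : hP.comparison.IsEquivalence where

end Comparison

/-! ### Transport of t-structures -/

section TStructure

open Pretriangulated Triangulated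

variable {C D : Type*} [Category* C] [Category* D] [Preadditive C] [Preadditive D]
  [HasZeroObject C] [HasZeroObject D] [HasShift C ℤ] [HasShift D ℤ]
  [∀ k : ℤ, (shiftFunctor C k).Additive] [∀ k : ℤ, (shiftFunctor D k).Additive]
  [Pretriangulated C] [Pretriangulated D]

/-- The inverse image of a t-structure by a triangulated equivalence. -/
def tStructureInverseImage (F : C ⥤ D) [F.CommShift ℤ] [F.IsTriangulated] [F.IsEquivalence]
    (t : TStructure D) : TStructure C where
  le k := (t.le k).inverseImage F
  ge k := (t.ge k).inverseImage F
  le_shift k a k' h X hX :=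
    (t.le k').prop_of_iso ((F.commShiftIso a).symm.app X) (t.le_shift k a k' h _ hX)
  ge_shift k a k' h X hX :=
    (t.ge k').prop_of_iso ((F.commShiftIso a).symm.app X) (t.ge_shift k a k' h _ hX)
  zero' X Y f hX hY := F.map_injective (by rw [t.zero' (F.map f) hX hY, F.map_zero])
  le_zero_le X hX := t.le_zero_le _ hX
  ge_one_le X hX := t.ge_one_le _ hX
  exists_triangle_zero_one Z := by
    obtain ⟨X, Y, hX, hY, f, g, h, hT⟩ := t.exists_triangle_zero_one (F.obj Z)
    let e := F.objObjPreimageIso X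
    let e' := F.objObjPreimageIso Y
    refine ⟨F.objPreimage X, F.objPreimage Y, (t.le 0).prop_of_iso e.symm hX,
      (t.ge 1).prop_of_iso e'.symm hY, F.preimage (e.hom ≫ f), F.preimage (g ≫ e'.inv),
      F.preimage (e'.hom ≫ h ≫ e.inv⟦1⟧' ≫ (F.commShiftIso (1 : ℤ)).inv.app _), ?_⟩
    rw [← F.map_distinguished_iff]
    refine isomorphic_distinguished _ hT _ (Triangle.isoMk _ _ e (Iso.refl _) e' ?_ ?_ ?_)
    · exact (Category.comp_id _).trans (F.map_preimage _)
    · have : F.map (F.preimage (g ≫ e'.inv)) ≫ e'.hom = g := by simp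
      exact this.trans (Category.id_comp g).symm
    · have : (F.map (F.preimage (e'.hom ≫ h ≫ e.inv⟦1⟧' ≫
          (F.commShiftIso (1 : ℤ)).inv.app (F.objPreimage X))) ≫
          (F.commShiftIso (1 : ℤ)).hom.app (F.objPreimage X)) ≫ e.hom⟦1⟧' = e'.hom ≫ h := by
        simp [← Functor.map_comp]
      exact this

end TStructure

/-! ### The right t-structure and its heart -/

section Heart

open Triangulated

variable {A : Type u} [Category.{v} A] [Abelian A] {n : ℕ} {P : ObjectProperty A}
  (hP : IsNTiltingTorsionClass n P)
  [HasZeroObject P.FullSubcategory] [HasBinaryBiproducts P.FullSubcategory]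
  [(acyclicComplexes (inducedExactStructure P)).IsTriangulated]
  [HasDerivedCategory.{w} A]

/-- The right t-structure on the derived category of a `n`-tilting torsion class. -/
def IsNTiltingTorsionClass.tStructure :
    TStructure (ExactDerivedCategory (inducedExactStructure P)) :=
  tStructureInverseImage hP.comparison DerivedCategory.TStructure.t

/-- The comparison functor sends the complex `K` to its image in `D(A)`. -/
def IsNTiltingTorsionClass.comparisonObjIso (K : CochainComplex P.FullSubcategory ℤ) :
    hP.comparison.obj ((quotientFunctor (inducedExactStructure P)).obj
      ((HomotopyCategory.quotient _ _).obj K)) ≅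
    DerivedCategory.Q.obj ((P.ι.mapHomologicalComplex _).obj K) :=
  hP.comparisonFactors.app _

include hP in
omit [HasZeroObject P.FullSubcategory] [HasBinaryBiproducts P.FullSubcategory]
  [(acyclicComplexes (inducedExactStructure P)).IsTriangulated]
  [HasDerivedCategory.{w} A] in
-- The only new nonzero term is `opcycles m`, a cosyzygy of every order.
lemma IsNTiltingTorsionClass.prop_truncGE (L : CochainComplex A ℤ) (hL : ∀ i, P (L.X i))
    (m : ℤ) [L.IsGE m] (i : ℤ) : P ((L.truncGE m).X i) := by
  rcases lt_or_ge i m with hi | hi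
  · exact hP.prop_of_isZero ((L.truncGE m).isZero_of_isStrictlyGE m i hi)
  · obtain rfl | hi := hi.eq_or_lt
    · exact hP.prop_of_iso (L.truncGEXIsoOpcycles m).symm
        (hP.prop_opcycles L hL m (fun i hi ↦ L.exactAt_of_isGE m i hi) m le_rfl)
    · exact hP.prop_of_iso (L.truncGEXIso m i hi).symm (hL i)

lemma IsNTiltingTorsionClass.tStructure_ge (m : ℤ) :
    hP.tStructure.ge m = rightCoaisle (inducedExactStructure P) m := by
  ext X
  constructor
  · intro hX
    obtain ⟨L, ⟨e⟩⟩ : ∃ L, Nonempty ((quotientFunctor (inducedExactStructure P)).obj L ≅ X) :=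
      ⟨_, ⟨(quotientFunctor (inducedExactStructure P)).objObjPreimageIso X⟩⟩
    obtain ⟨K, rfl⟩ := HomotopyCategory.quotient_obj_surjective L
    let K' : CochainComplex A ℤ := (P.ι.mapHomologicalComplex _).obj K
    have h : (DerivedCategory.Q.obj K').IsGE m :=
      ⟨(DerivedCategory.TStructure.t.ge m).prop_of_iso
        (hP.comparison.mapIso e.symm ≪≫ hP.comparisonObjIso K) hX⟩
    rw [DerivedCategory.isGE_Q_obj_iff] at h
    let T := (K'.truncGE m).liftObjectProperty P (hP.prop_truncGE K' (fun i ↦ (K.X i).2) m)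
    refine ⟨T, fun i hi ↦ ?_, ⟨e.symm ≪≫ hP.comparison.preimageIso
      (hP.comparisonObjIso K ≪≫ asIso (DerivedCategory.Q.map (K'.πTruncGE m)) ≪≫
        (hP.comparisonObjIso T).symm)⟩⟩
    rw [IsZero.iff_id_eq_zero]
    exact P.ι.map_injective
      (((K'.truncGE m).isZero_of_isStrictlyGE m i hi).eq_of_src _ _)
  · rintro ⟨K, hK, ⟨e⟩⟩
    refine ⟨(P.ι.mapHomologicalComplex _).obj K,
      hP.comparison.mapIso e ≪≫ hP.comparisonObjIso K, ?_⟩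
    rw [CochainComplex.isStrictlyGE_iff]
    exact fun i hi ↦ P.ι.map_isZero (hK i hi)

/-- The composition of `E ⥤ K(E) ⥤ K(E)/N` and `K(E)/N ⥤ D(A)` is the restriction of
the canonical functor `A ⥤ D(A)`. -/
def IsNTiltingTorsionClass.singleFunctorCompComparison :
    (HomotopyCategory.singleFunctors P.FullSubcategory).functor 0 ⋙
      quotientFunctor (inducedExactStructure P) ⋙ hP.comparison ≅
    P.ι ⋙ DerivedCategory.singleFunctor A 0 :=
  Functor.isoWhiskerLeft _ hP.comparisonFactors ≪≫
    Functor.isoWhiskerRight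
      (HomologicalComplex.singleMapHomologicalComplex P.ι (ComplexShape.up ℤ) 0)
      (HomotopyCategory.quotient _ _ ⋙ DerivedCategory.Qh)

lemma IsNTiltingTorsionClass.heart_obj (X : A) :
    hP.tStructure.heart
      ((DerivedCategory.singleFunctor A 0 ⋙ hP.comparison.inv).obj X) := by
  have e := hP.comparison.asEquivalence.counitIso.app
    ((DerivedCategory.singleFunctor A 0).obj X)
  exact ⟨(DerivedCategory.TStructure.t.le 0).prop_of_iso e.symm
    (inferInstance : ((DerivedCategory.singleFunctor A 0).obj X).IsLE 0).le,
   (DerivedCategory.TStructure.t.ge 0).prop_of_iso e.symm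
    (inferInstance : ((DerivedCategory.singleFunctor A 0).obj X).IsGE 0).ge⟩

/-- The functor from `A` to the heart of the right t-structure. -/
def IsNTiltingTorsionClass.toHeart : A ⥤ hP.tStructure.heart.FullSubcategory :=
  hP.tStructure.heart.lift (DerivedCategory.singleFunctor A 0 ⋙ hP.comparison.inv) hP.heart_obj

/-- The composition of the functor from `A` to the heart and `Φ` is the embedding in `D(A)`. -/
def IsNTiltingTorsionClass.toHeartCompComparison :
    hP.toHeart ⋙ hP.tStructure.heart.ι ⋙ hP.comparison ≅ DerivedCategory.singleFunctor A 0 :=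
  Functor.isoWhiskerLeft (DerivedCategory.singleFunctor A 0)
    hP.comparison.asEquivalence.counitIso ≪≫ Functor.rightUnitor _

instance : hP.toHeart.Full :=
  inferInstanceAs (hP.tStructure.heart.lift _ hP.heart_obj).Full

instance : hP.toHeart.Faithful :=
  inferInstanceAs (hP.tStructure.heart.lift _ hP.heart_obj).Faithful

instance : hP.toHeart.EssSurj where
  mem_essImage Y := by
    have : (hP.comparison.obj Y.1).IsLE 0 := ⟨Y.2.1⟩
    have : (hP.comparison.obj Y.1).IsGE 0 := ⟨Y.2.2⟩
    obtain ⟨X, ⟨e⟩⟩ :=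
      DerivedCategory.exists_iso_singleFunctor_obj_of_isGE_of_isLE (hP.comparison.obj Y.1) 0
    exact ⟨X, ⟨hP.tStructure.heart.ι.preimageIso (hP.comparison.preimageIso
      (hP.toHeartCompComparison.app X ≪≫ e.symm))⟩⟩

instance : hP.toHeart.IsEquivalence where

/-- The restriction to `E` of the functor from `A` to the heart. -/
def IsNTiltingTorsionClass.ιCompToHeart :
    P.ι ⋙ hP.toHeart ⋙ hP.tStructure.heart.ι ≅
      (HomotopyCategory.singleFunctors P.FullSubcategory).functor 0 ⋙
        quotientFunctor (inducedExactStructure P) :=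
  -- As `Φ` is fully faithful, it suffices to compare the two functors after composition with `Φ`.
  ((Functor.FullyFaithful.ofFullyFaithful hP.comparison).whiskeringRight
    P.FullSubcategory).preimageIso
      (Functor.isoWhiskerLeft P.ι hP.toHeartCompComparison ≪≫
        hP.singleFunctorCompComparison.symm)

end Heart

/-! ### Pullbacks of extensions, and extension of maps along triangles -/

section Pullback

open Pretriangulated

lemma exists_shortExact_pullback {A : Type*} [Category* A] [Abelian A] {S : ShortComplex A}
    (hS : S.ShortExact) {M : A} (p : M ⟶ S.X₃) :
    ∃ (f : S.X₁ ⟶ pullback S.g p) (_ : f ≫ pullback.fst S.g p = S.f)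
      (zero : f ≫ pullback.snd S.g p = 0),
      (ShortComplex.mk f (pullback.snd S.g p) zero).ShortExact := by
  have := hS.mono_f
  have := hS.epi_g
  let f : S.X₁ ⟶ pullback S.g p := pullback.lift S.f 0 (by simp)
  have hf : f ≫ pullback.fst S.g p = S.f := pullback.lift_fst _ _ _
  have : Mono f := mono_of_mono_fac hf
  refine ⟨f, hf, pullback.lift_snd _ _ _,
    { exact := ShortComplex.exact_of_f_is_kernel _ (KernelFork.IsLimit.ofι' f _ (fun k hk ↦
        ⟨hS.fIsKernel.lift (KernelFork.ofι (k ≫ pullback.fst S.g p) ?_), ?_⟩)) }⟩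
  · rw [Category.assoc, pullback.condition, reassoc_of% hk, zero_comp]
  · apply pullback.hom_ext
    · rw [Category.assoc, hf]
      exact hS.fIsKernel.fac _ WalkingParallelPair.zero
    · have hf' : f ≫ pullback.snd S.g p = 0 := pullback.lift_snd _ _ _
      refine (Category.assoc _ _ _).trans ?_
      rw [hf', comp_zero]
      exact hk.symm

lemma exists_eq_mor₁_comp {C : Type*} [Category* C] [Preadditive C] [HasZeroObject C]
    [HasShift C ℤ] [∀ k : ℤ, (shiftFunctor C k).Additive] [Pretriangulated C]
    (T : Triangle C) (hT : T ∈ distTriang C) {Y : C} (φ : T.obj₁ ⟶ Y)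
    (hφ : T.mor₃ ≫ φ⟦(1 : ℤ)⟧' = 0) : ∃ ψ : T.obj₂ ⟶ Y, φ = T.mor₁ ≫ ψ := by
  obtain ⟨ψ, hψ⟩ := Triangle.yoneda_exact₃ _ (rot_of_distTriang _ hT) (φ⟦1⟧') hφ
  obtain ⟨ψ : T.obj₂ ⟶ Y, rfl⟩ := (shiftFunctor _ (1 : ℤ)).map_surjective ψ
  -- The third map of the rotated triangle is `-T.mor₁⟦1⟧'`, whence the sign.
  refine ⟨-ψ, (shiftFunctor _ (1 : ℤ)).map_injective ?_⟩
  have hψ : φ⟦(1 : ℤ)⟧' = (-T.mor₁⟦1⟧') ≫ ψ⟦1⟧' := hψ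
  rw [hψ]
  simp

end Pullback

/-! ### Effaceability in the derived category -/

section Effaceable

open Pretriangulated

variable {A : Type u} [Category.{v} A] [Abelian A]

/-- A complex in `A` is `D(E, Ex)`-exact in degree `j`: any morphism from an object of `E` to the
cycles lifts to `L.X (j - 1)` after composition with an epimorphism whose kernel is in `E`. -/
def IsDExactAt (P : ObjectProperty A) (L : CochainComplex A ℤ) (j : ℤ) : Prop :=
  ∀ ⦃W : A⦄, P W → ∀ (w : W ⟶ L.X j), w ≫ L.d j (j + 1) = 0 →
    ∃ (N : A) (π : N ⟶ W) (k : N ⟶ L.X (j - 1)), Epi π ∧ P (kernel π) ∧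
      π ≫ w = k ≫ L.d (j - 1) j

lemma IsDExactAt.shift {P : ObjectProperty A} {L : CochainComplex A ℤ} {i j k : ℤ}
    (hL : IsDExactAt P L k) (h : j + i = k) :
    IsDExactAt P ((CategoryTheory.shiftFunctor (CochainComplex A ℤ) i).obj L) j := by
  subst h
  intro W hW (w : W ⟶ L.X (j + i)) hw
  have hw' : w ≫ L.d (j + i) (j + i + 1) = 0 := by
    have : w ≫ L.d (j + i) (j + 1 + i) = 0 := by
      have hw : w ≫ (i.negOnePow • L.d (j + i) (j + 1 + i)) = 0 := hw
      rwa [Linear.comp_units_smul, smul_eq_zero_iff_eq] at hw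
    obtain h | h := eq_or_ne (j + i + 1) (j + 1 + i)
    · rw [h]
      exact this
    · exact (h (by ring)).elim
  obtain ⟨N, π, k, hπ, hπ', fac⟩ := hL hW w hw'
  have e : j + i - 1 = j - 1 + i := by ring
  -- This sign cancels the one carried by the differentials of the shifted complex.
  refine ⟨N, π, i.negOnePow • k ≫ (L.XIsoOfEq e).hom, hπ, hπ', ?_⟩
  simp [fac, smul_smul]

/-- The morphisms from `M` to `Y` in the derived category become zero after composition with
a suitable epimorphism with a kernel in `E`. -/
def IsEffaceable [HasDerivedCategory.{w} A] (P : ObjectProperty A) (Y : DerivedCategory A)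
    (M : A) : Prop :=
  ∀ (φ : (DerivedCategory.singleFunctor A 0).obj M ⟶ Y), ∃ (N : A) (q : N ⟶ M), Epi q ∧
    P (kernel q) ∧ (DerivedCategory.singleFunctor A 0).map q ≫ φ = 0

variable [HasDerivedCategory.{w} A]

lemma IsEffaceable.of_iso {P : ObjectProperty A} {Y Y' : DerivedCategory A} {M : A}
    (h : IsEffaceable P Y M) (e : Y ≅ Y') : IsEffaceable P Y' M := fun φ ↦ by
  obtain ⟨N, q, hq, hq', fac⟩ := h (φ ≫ e.inv)
  exact ⟨N, q, hq, hq', by rw [← cancel_mono e.inv, Category.assoc, fac, zero_comp]⟩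

/-- Efface the canonical map from the cycles to `L`: on homology it induces `homologyπ`, which is
therefore killed by an epimorphism. -/
lemma isZero_homology_of_isEffaceable {P : ObjectProperty A} (L : CochainComplex A ℤ)
    (h : IsEffaceable P (DerivedCategory.Q.obj L) (L.cycles 0)) : L.ExactAt 0 := by
  obtain ⟨N, q, _, _, fac⟩ := h (DerivedCategory.Q.map
    (HomologicalComplex.mkHomFromSingle (L.iCycles 0) (by simp)))
  let f : (HomologicalComplex.single A (.up ℤ) 0).obj N ⟶ L :=
    (HomologicalComplex.single A _ 0).map q ≫
      HomologicalComplex.mkHomFromSingle (L.iCycles 0) (by simp)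
  have hf : DerivedCategory.Q.map f = 0 := by
    dsimp only [f]
    rw [Functor.map_comp]
    exact fac
  have hf' : HomologicalComplex.homologyMap f 0 = 0 := by
    have := DerivedCategory.homologyFunctorFactors_hom_naturality f 0
    rw [hf, Functor.map_zero, zero_comp] at this
    exact (cancel_epi ((DerivedCategory.homologyFunctorFactors A 0).hom.app _)).1
      (this.symm.trans comp_zero.symm)
  have hq : (HomologicalComplex.singleObjCyclesSelfIso (.up ℤ) 0 N).inv ≫
      HomologicalComplex.cyclesMap f 0 = q := by
    rw [← cancel_mono (L.iCycles 0)]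
    simp [f, HomologicalComplex.single_map_f_self]
  have : L.homologyπ 0 = 0 := by
    rw [← cancel_epi q, comp_zero, ← hq, Category.assoc, ← HomologicalComplex.homologyπ_naturality,
      hf', comp_zero, comp_zero]
  rw [HomologicalComplex.exactAt_iff_isZero_homology, IsZero.iff_id_eq_zero,
    ← cancel_epi (L.homologyπ 0), this, zero_comp, zero_comp]

lemma Q_map_eq_zero_of_eq_comp_d {N : A} {L : CochainComplex A ℤ}
    (f : (HomologicalComplex.single A (.up ℤ) 0).obj N ⟶ L) (i : ℤ) (hi : i + 1 = 0)
    (k : N ⟶ L.X i)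
    (hk : f.f 0 = (HomologicalComplex.singleObjXSelf (.up ℤ) 0 N).hom ≫ k ≫ L.d i 0) :
    DerivedCategory.Q.map f = 0 := by
  rw [← DerivedCategory.Q.map_zero]
  refine DerivedCategory.Q_map_eq_of_homotopy (C := A)
    ((CochainComplex.HomComplex.Cochain.equivHomotopy (F :=
      (CochainComplex.singleFunctor A 0).obj N) f 0).symm
    ⟨CochainComplex.HomComplex.Cochain.fromSingleMk k (p := 0) (q := i) (n := -1)
      (by lia), ?_⟩)
  rw [CochainComplex.HomComplex.Cochain.δ_fromSingleMk k _ 0 0 (by simp),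
    CochainComplex.HomComplex.Cochain.ofHom_zero, add_zero]
  apply (CochainComplex.HomComplex.Cochain.fromSingleEquiv (add_zero 0)).injective
  rw [CochainComplex.HomComplex.Cochain.fromSingleEquiv_fromSingleMk]
  change (HomologicalComplex.singleObjXSelf (.up ℤ) 0 N).inv ≫
    (CochainComplex.HomComplex.Cochain.ofHom f).v 0 0 _ = _
  rw [CochainComplex.HomComplex.Cochain.ofHom_v, hk, Iso.inv_hom_id_assoc]

variable {n : ℕ} {P : ObjectProperty A} (hP : IsNTiltingTorsionClass n P)

include hP

omit [HasDerivedCategory A] in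
lemma IsNTiltingTorsionClass.prop_kernel_pullback_fst {X Y Z : A} (f : X ⟶ Z) (g : Y ⟶ Z)
    (hg : P (kernel g)) : P (kernel (pullback.fst f g)) := by
  have sq := (IsPullback.of_hasPullback f g)
  have := isIso_kernel_map_of_isPullback sq
  exact hP.prop_of_iso (asIso (kernel.map _ _ _ _ sq.w)).symm hg

/-- Effacing the composition `X₃ ⟶ X₁⟦1⟧ ⟶ Y⟦1⟧` by `p` and pulling the extension back along `p`
lets `φ` extend to the pullback. This lies in `E`, being an extension of `X₂` by `kernel p`, so the
extended map can be effaced and the result pulled back to `X₁`. -/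
lemma IsNTiltingTorsionClass.isEffaceable_of_shortExact {S : ShortComplex A} (hS : S.ShortExact)
    (h₂ : P S.X₂) {Y : DerivedCategory A} (hY : ∀ ⦃V⦄, P V → IsEffaceable P Y V)
    (h₃ : IsEffaceable P (Y⟦(1 : ℤ)⟧) S.X₃) : IsEffaceable P Y S.X₁ := by
  intro φ
  have := hS.mono_f
  have := hS.epi_g
  obtain ⟨M, p, _, hp, fac⟩ := h₃ (hS.singleδ ≫ φ⟦1⟧')
  obtain ⟨T₁, hT₁, zero, hT⟩ := exists_shortExact_pullback hS p
  have hV : P (pullback S.g p) := hP.prop_of_prop_kernel (pullback.fst S.g p)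
    (hP.prop_kernel_pullback_fst S.g p hp) h₂
  obtain ⟨ψ : (DerivedCategory.singleFunctor A 0).obj (pullback S.g p) ⟶ Y, hψ⟩ :=
    exists_eq_mor₁_comp _ hT.singleTriangle_distinguished φ (by
    have := (ShortComplex.ShortExact.singleTriangle.map hT hS
      { τ₁ := 𝟙 _, τ₂ := pullback.fst _ _, τ₃ := p, comm₁₂ := (Category.id_comp _).trans hT₁.symm,
        comm₂₃ := pullback.condition }).comm₃
    have hδ : hT.singleδ = (DerivedCategory.singleFunctor A 0).map p ≫ hS.singleδ := by
      refine Eq.trans ?_ this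
      exact (Category.comp_id _).symm.trans (congrArg (hT.singleδ ≫ ·)
        (((shiftFunctor (DerivedCategory A) (1 : ℤ)).congr_map
          ((DerivedCategory.singleFunctor A 0).map_id S.X₁)).trans
            (CategoryTheory.Functor.map_id _ _)).symm)
    change hT.singleδ ≫ _ = 0
    rw [hδ]
    exact (Category.assoc _ _ _).trans fac)
  obtain ⟨N, q, _, hq, fac'⟩ := hY hV ψ
  refine ⟨pullback T₁ q, pullback.fst _ _, inferInstance,
    hP.prop_kernel_pullback_fst _ _ hq, ?_⟩
  have hψ' : φ = (DerivedCategory.singleFunctor A 0).map T₁ ≫ ψ := hψ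
  rw [hψ', ← Functor.map_comp_assoc, pullback.condition, Functor.map_comp_assoc, fac', comp_zero]

/-- Dimension shifting: embedding `M` in `E` costs one shift of `Y` and raises the order of the
quotient by one; after `k` steps the quotient is in `E`. -/
lemma IsNTiltingTorsionClass.isEffaceable_of_isCosyzygy (k r : ℕ) (hr : k + r = n)
    {M : A} (hM : IsCosyzygy P r M) (Y : DerivedCategory A)
    (hY : ∀ (i : ℕ), i ≤ k → ∀ ⦃V⦄, P V → IsEffaceable P (Y⟦(i : ℤ)⟧) V) :
    IsEffaceable P Y M := by
  have h₀ : ∀ ⦃V⦄, P V → IsEffaceable P Y V := fun V hV ↦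
    (hY 0 (by simp) hV).of_iso ((shiftFunctorZero _ ℤ).app Y)
  induction k generalizing r M Y with
  | zero =>
    obtain rfl : r = n := by omega
    exact h₀ (hP.prop_of_isCosyzygy hM)
  | succ k hk =>
    obtain ⟨V, i, hV, hi⟩ := hP.cogenerates M
    have hS : (ShortComplex.mk i (cokernel.π i) (by simp)).ShortExact :=
      { exact := ShortComplex.exact_cokernel i }
    have hY' (j : ℕ) (hj : j ≤ k) ⦃V : A⦄ (hV : P V) :
        IsEffaceable P (Y⟦(1 : ℤ)⟧⟦(j : ℤ)⟧) V :=
      (hY (j + 1) (by omega) hV).of_iso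
        ((shiftFunctorAdd' _ (1 : ℤ) (j : ℤ) ((j + 1 : ℕ) : ℤ) (by simp; ring)).app Y)
    exact hP.isEffaceable_of_shortExact hS hV h₀
      (hk (r + 1) (by omega) (.of_shortExact hS hM hV) _ hY'
        (fun V hV ↦ (hY' 0 (by simp) hV).of_iso ((shiftFunctorZero _ ℤ).app _)))

end Effaceable

/-! ### `D`-exact complexes are exact far to the left -/

section DExact

variable {A : Type u} [Category.{v} A] [Abelian A] {n : ℕ} {P : ObjectProperty A}

lemma shortExact_opcyclesToCycles_homologyπ (L : CochainComplex A ℤ) (i j : ℤ) (hij : i + 1 = j)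
    (hL : L.ExactAt i) :
    (ShortComplex.mk (L.opcyclesToCycles i j) (L.homologyπ j) (by simp)).ShortExact := by
  let φ : ShortComplex.mk (L.toCycles i j) (L.homologyπ j) (by simp) ⟶
    ShortComplex.mk (L.opcyclesToCycles i j) (L.homologyπ j) (by simp) :=
    { τ₁ := L.pOpcycles i, τ₂ := 𝟙 _, τ₃ := 𝟙 _ }
  have : Epi φ.τ₁ := inferInstanceAs (Epi (L.pOpcycles i))
  have : IsIso φ.τ₂ := by dsimp [φ]; infer_instance
  have : Mono φ.τ₃ := by dsimp [φ]; infer_instance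
  have : Mono (L.fromOpcycles i j) :=
    (shortExact_fromOpcycles_pOpcycles L i j hij hL).mono_f
  exact
    { exact := (ShortComplex.exact_iff_of_epi_of_isIso_of_mono φ).1
        (ShortComplex.exact_of_g_is_cokernel _ (L.homologyIsCokernel i j (by simp [← hij])))
      mono_f := mono_of_mono_fac (L.opcyclesToCycles_iCycles i j)
      epi_g := inferInstanceAs (Epi (L.homologyπ j)) }

variable (hP : IsNTiltingTorsionClass n P)

include hP in
lemma IsNTiltingTorsionClass.prop_kernel_of_shortExact {S : ShortComplex A} (hS : S.ShortExact)
    (h : P S.X₁) : P (kernel S.g) :=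
  hP.prop_of_iso (hS.fIsKernel.conePointUniqueUpToIso (limit.isLimit (parallelPair S.g 0))) h

include hP in
-- Exactness below `j` identifies this kernel with `opcycles (j - 1)`.
lemma IsNTiltingTorsionClass.prop_kernel_homologyπ (L : CochainComplex A ℤ)
    (hL : ∀ i, P (L.X i)) (j : ℤ) (h : ∀ i < j, L.ExactAt i) :
    P (kernel (L.homologyπ j)) :=
  hP.prop_kernel_of_shortExact
    (shortExact_opcyclesToCycles_homologyπ L (j - 1) j (by simp) (h _ (by simp)))
    (hP.prop_opcycles L hL j h _ (by simp))

variable [HasDerivedCategory.{w} A]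

section

variable [HasZeroObject P.FullSubcategory] [HasBinaryBiproducts P.FullSubcategory]
  [(acyclicComplexes (inducedExactStructure P)).IsTriangulated]

omit [(acyclicComplexes (inducedExactStructure P)).IsTriangulated] in
lemma IsNTiltingTorsionClass.comparisonObjIso_hom_naturality
    {K L : CochainComplex P.FullSubcategory ℤ} (f : K ⟶ L) :
    hP.comparison.map ((quotientFunctor (inducedExactStructure P)).map
      ((HomotopyCategory.quotient _ _).map f)) ≫ (hP.comparisonObjIso L).hom =
    (hP.comparisonObjIso K).hom ≫
      DerivedCategory.Q.map ((P.ι.mapHomologicalComplex _).map f) :=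
  hP.comparisonFactors.hom.naturality ((HomotopyCategory.quotient _ _).map f)

end

include hP in
/-- Any morphism in `D(A)` between complexes in `E` is represented by a right fraction of
complexes in `E`. -/
lemma IsNTiltingTorsionClass.exists_rightFraction
    (K L : CochainComplex P.FullSubcategory ℤ)
    (ψ : DerivedCategory.Q.obj ((P.ι.mapHomologicalComplex _).obj K) ⟶
      DerivedCategory.Q.obj ((P.ι.mapHomologicalComplex _).obj L)) :
    ∃ (U : CochainComplex P.FullSubcategory ℤ) (s : U ⟶ K) (g : U ⟶ L),
      QuasiIso ((P.ι.mapHomologicalComplex _).map s) ∧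
      DerivedCategory.Q.map ((P.ι.mapHomologicalComplex _).map s) ≫ ψ =
        DerivedCategory.Q.map ((P.ι.mapHomologicalComplex _).map g) := by
  have := hP.hasZeroObject
  have := hP.hasBinaryBiproducts
  have := hP.isTriangulated_acyclicComplexes
  obtain ⟨ψ', hψ'⟩ := hP.comparison.map_surjective
    ((hP.comparisonObjIso K).hom ≫ ψ ≫ (hP.comparisonObjIso L).inv)
  obtain ⟨ρ, rfl⟩ := Localization.exists_rightFraction
    (quotientFunctor (inducedExactStructure P))
    (acyclicComplexes (inducedExactStructure P)).trW ψ'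
  obtain @⟨X, s, hs, f⟩ := ρ
  obtain ⟨U, rfl⟩ := HomotopyCategory.quotient_obj_surjective X
  obtain ⟨s, rfl⟩ := (HomotopyCategory.quotient _ _).map_surjective s
  obtain ⟨g, rfl⟩ := (HomotopyCategory.quotient _ _).map_surjective f
  have fac := MorphismProperty.RightFraction.map_s_comp_map
    (MorphismProperty.RightFraction.mk _ hs ((HomotopyCategory.quotient _ _).map g))
    (quotientFunctor (inducedExactStructure P))
    (Localization.inverts _ (acyclicComplexes (inducedExactStructure P)).trW)
  dsimp only at fac
  refine ⟨U, s, g, ?_, ?_⟩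
  · rw [← DerivedCategory.isIso_Q_map_iff_quasiIso]
    exact (hP.trW_acyclicComplexes_iff _).1 hs
  · rw [← cancel_epi (hP.comparisonObjIso U).hom, ← hP.comparisonObjIso_hom_naturality,
      ← reassoc_of% hP.comparisonObjIso_hom_naturality, ← cancel_mono (hP.comparisonObjIso L).inv,
      Category.assoc, Category.assoc, ← hψ', Category.assoc, Iso.hom_inv_id, Category.comp_id,
      ← Functor.map_comp, fac]

include hP in
-- Represent the map by `M ⟵ U ⟶ L` with `U` over `E`. Then `U.cycles 0 ⟶ M` is epi with kernel in
-- `E`, so the cycles lie in `E`, and `D`-exactness makes their map to `L.X 0` a boundary after one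
-- more such epi.
lemma IsNTiltingTorsionClass.isEffaceable_of_isDExactAt (L : CochainComplex A ℤ)
    (hL : ∀ i, P (L.X i)) (h : IsDExactAt P L 0) ⦃M : A⦄ (hM : P M) :
    IsEffaceable P (DerivedCategory.Q.obj L) M := by
  intro (φ : DerivedCategory.Q.obj ((HomologicalComplex.single A (.up ℤ) 0).obj M) ⟶ _)
  have := hP.hasZeroObject
  obtain ⟨U, s, g, hs, fac⟩ := hP.exists_rightFraction
    ((HomologicalComplex.single _ _ 0).obj ⟨M, hM⟩) (L.liftObjectProperty P hL)
    (DerivedCategory.Q.map ((HomologicalComplex.singleMapHomologicalComplex P.ι (.up ℤ) 0).app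
      ⟨M, hM⟩).hom ≫ φ)
  let U' : CochainComplex A ℤ := (P.ι.mapHomologicalComplex _).obj U
  let σ : U' ⟶ (HomologicalComplex.single A (.up ℤ) 0).obj M :=
    (P.ι.mapHomologicalComplex _).map s ≫
      ((HomologicalComplex.singleMapHomologicalComplex P.ι (.up ℤ) 0).app ⟨M, hM⟩).hom
  let γ : U' ⟶ L := (P.ι.mapHomologicalComplex _).map g
  have hσ : QuasiIso σ := by
    dsimp only [σ]
    infer_instance
  replace fac : DerivedCategory.Q.map σ ≫ φ = DerivedCategory.Q.map γ := by
    refine Eq.trans ?_ fac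
    dsimp only [σ]
    rw [Functor.map_comp, Category.assoc]
    rfl
  clear_value σ
  have hU (i : ℤ) (hi : i < 0) : U'.ExactAt i :=
    (quasiIsoAt_iff_exactAt' σ i
      (HomologicalComplex.exactAt_single_obj _ _ _ _ hi.ne)).1 inferInstance
  let e := asIso (HomologicalComplex.homologyMap σ 0) ≪≫
    HomologicalComplex.singleObjHomologySelfIso (.up ℤ) 0 M
  let c : U'.cycles 0 ⟶ M := U'.homologyπ 0 ≫ e.hom
  have hc : P (kernel c) :=
    hP.prop_of_iso (kernelCompMono _ _).symm
      (hP.prop_kernel_homologyπ U' (fun i ↦ (U.X i).2) 0 hU)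
  have hc' : c = U'.iCycles 0 ≫ σ.f 0 ≫ (HomologicalComplex.singleObjXSelf (.up ℤ) 0 M).hom := by
    simp [c, e, HomologicalComplex.singleObjCyclesSelfIso_hom]
  obtain ⟨N, π, k, _, hπ, fac'⟩ := h (hP.prop_of_prop_kernel c hc hM)
    (U'.iCycles 0 ≫ γ.f 0) (by simp)
  refine ⟨N, π ≫ c, inferInstance, hP.prop_kernel_comp _ _ hπ hc, ?_⟩
  let z : (HomologicalComplex.single A (.up ℤ) 0).obj (U'.cycles 0) ⟶ U' :=
    HomologicalComplex.mkHomFromSingle (U'.iCycles 0) (by simp)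
  have hz : (HomologicalComplex.single A (.up ℤ) 0).map c = z ≫ σ := by
    ext
    simp [hc', z, HomologicalComplex.single_map_f_self]
  have : (DerivedCategory.singleFunctor A 0).map (π ≫ c) ≫ φ =
      DerivedCategory.Q.map ((HomologicalComplex.single A (.up ℤ) 0).map π ≫ z ≫ γ) := by
    have : (HomologicalComplex.single A (.up ℤ) 0).map (π ≫ c) =
        ((HomologicalComplex.single A (.up ℤ) 0).map π ≫ z) ≫ σ := by
      rw [Functor.map_comp, hz, Category.assoc]
    change DerivedCategory.Q.map ((HomologicalComplex.single A (.up ℤ) 0).map (π ≫ c)) ≫ φ = _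
    rw [this, ← Category.assoc, Functor.map_comp, Category.assoc, fac, ← Functor.map_comp]
  rw [this]
  exact Q_map_eq_zero_of_eq_comp_d _ (0 - 1) (by simp) k
    (by simp [z, HomologicalComplex.single_map_f_self, fac'])

include hP in
-- The cycles are an arbitrary object, a 0-cosyzygy, so `D`-exactness is needed in degrees `a, …, a
-- + n`, all negative precisely when `a < -n`.
lemma IsNTiltingTorsionClass.exactAt_of_isDExactAt (L : CochainComplex A ℤ)
    (hL : ∀ i, P (L.X i)) (h : ∀ i < 0, IsDExactAt P L i) (a : ℤ) (ha : a < - n) :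
    L.ExactAt a := by
  have : (L⟦a⟧).ExactAt 0 := isZero_homology_of_isEffaceable (P := P) _
    (hP.isEffaceable_of_isCosyzygy n 0 (by simp) (M := (L⟦a⟧).cycles 0) trivial _
      (fun i hi V hV ↦ (hP.isEffaceable_of_isDExactAt (L⟦a⟧⟦(i : ℤ)⟧) (fun _ ↦ hL _)
        (((h (a + i) (by lia)).shift (add_comm _ _)).shift (by simp)) hV).of_iso
          ((DerivedCategory.Q.commShiftIso (i : ℤ)).app _)))
  rw [HomologicalComplex.exactAt_iff_isZero_homology] at this ⊢
  exact this.of_iso (((HomologicalComplex.homologyFunctor A (.up ℤ) 0).shiftIso a 0 a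
    (by simp)).app L).symm

end DExact

/-! ### Infinite left extension by `D`-kernels -/

section DKernelResolution

variable {E : Type*} [Category* E] [Preadditive E] {Ex : ObjectProperty (ShortComplex E)}

lemma IsDKernel.of_iso {K X Y K' X' Y' : E} {i : K ⟶ X} {f : X ⟶ Y} (h : IsDKernel Ex i f)
    {i' : K' ⟶ X'} {f' : X' ⟶ Y'} (e₁ : K ≅ K') (e₂ : X ≅ X') (e₃ : Y ≅ Y')
    (hi : i' = e₁.inv ≫ i ≫ e₂.hom) (hf : f' = e₂.inv ≫ f ≫ e₃.hom) : IsDKernel Ex i' f' := by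
  subst hi hf
  refine ⟨by simp [reassoc_of% h.1], fun W j hj ↦ ?_⟩
  obtain ⟨N, π, k, hπ, fac⟩ := h.2 W (j ≫ e₂.inv) (by
    rw [← cancel_mono e₃.hom, zero_comp]
    simpa using hj)
  refine ⟨N, π, k ≫ e₁.hom, hπ, ?_⟩
  rw [← cancel_mono e₂.inv]
  simpa using fac

/-- A morphism is a `D(E, Ex)`-kernel of another one, up to an isomorphism between
the target of the former and the source of the latter. -/
def IsDKernelLink (Ex : ObjectProperty (ShortComplex E)) (a b : Arrow E) : Prop :=
  ∃ e : b.right ≅ a.left, IsDKernel Ex (b.hom ≫ e.hom) a.hom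

/-- The family lists the maps of `S` backwards from the `i`-th one, then continues with chosen
`D`-kernels. Links up to isomorphism avoid equalities between objects. -/
lemma exists_infinite_isDKernelLink (hE : HasDKernels Ex) {l : ℕ} (S : ComposableArrows E (l + 1))
    (hS : IsDKernelSequence Ex S) (i : ℕ) (hi : i ≤ l) :
    ∃ a : ℕ → Arrow E, (∀ k, IsDKernelLink Ex (a k) (a (k + 1))) ∧
      a 0 = Arrow.mk (S.map' i (i + 1)) ∧ a i = Arrow.mk (S.map' 0 1) := by
  induction i with
  | zero =>
    have (a : Arrow E) : ∃ b, IsDKernelLink Ex a b := by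
      obtain ⟨K, i, h⟩ := hE _ _ a.hom
      exact ⟨Arrow.mk i, Iso.refl _, by simpa using h⟩
    choose next hnext using this
    refine ⟨fun k ↦ next^[k] (Arrow.mk (S.map' 0 1)), fun k ↦ ?_, rfl, rfl⟩
    dsimp only
    rw [Function.iterate_succ_apply']
    exact hnext _
  | succ i hi' =>
    obtain ⟨a, ha, ha₀, hai⟩ := hi' (by omega)
    refine ⟨fun k ↦ Nat.casesOn k (Arrow.mk (S.map' (i + 1) (i + 1 + 1))) a, fun k ↦ ?_, rfl, hai⟩
    obtain _ | k := k
    · change IsDKernelLink Ex _ (a 0)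
      rw [ha₀]
      exact ⟨Iso.refl _, by simpa using hS i (by omega)⟩
    · exact ha k

variable [HasZeroObject E]

/-- A sequence of morphisms, each of which is a `D(E, Ex)`-kernel of the next one, extends
to a complex in nonpositive degrees. -/
lemma exists_cochainComplex_of_isDKernelSequence (hE : HasDKernels Ex) {l : ℕ}
    (S : ComposableArrows E (l + 1)) (hS : IsDKernelSequence Ex S) :
    ∃ K : CochainComplex E ℤ,
      (∀ i < 0, IsDKernel Ex (K.d (i - 1) i) (K.d i (i + 1))) ∧
      Nonempty (Arrow.mk (K.d (-(l + 1)) (-l)) ≅ Arrow.mk (S.map' 0 1)) := by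
  obtain ⟨a, ha, -, hal⟩ := exists_infinite_isDKernelLink hE S hS l le_rfl
  choose e he using ha
  let X (k : ℕ) : E := Nat.casesOn k (a 0).right (fun k ↦ (a k).left)
  let d (k : ℕ) : X (k + 1) ⟶ X k := match k with
    | 0 => (a 0).hom
    | k + 1 => (a (k + 1)).hom ≫ (e k).hom
  have hd (k : ℕ) : IsDKernel Ex (d (k + 1)) (d k) := by
    obtain _ | k := k
    · exact he 0
    · refine (he (k + 1)).of_iso (Iso.refl _) (Iso.refl _) (e k) ?_ ?_
      · change _ = 𝟙 _ ≫ ((a (k + 1 + 1)).hom ≫ (e (k + 1)).hom) ≫ 𝟙 _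
        rw [Category.id_comp, Category.comp_id]
      · exact (Category.id_comp _).symm
  have hd' (k : ℕ) : Nonempty (Arrow.mk (d k) ≅ a k) := by
    obtain _ | k := k
    · exact ⟨Iso.refl _⟩
    · exact ⟨Arrow.isoMk (Iso.refl _) (e k).symm (by simp [d])⟩
  let C := ChainComplex.of X d (fun k ↦ (hd k).1)
  have hC (k : ℕ) : C.d (k + 1) k = d k := ChainComplex.of_d _ _ _
  let K := C.extend ComplexShape.embeddingDownNat
  have hK (k : ℕ) (i : ℤ) (h : -(k : ℤ) = i) : ComplexShape.embeddingDownNat.f k = i := h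
  have hl : -((l + 1 : ℕ) : ℤ) = -(l + 1) := by push_cast; rfl
  let el : Arrow.mk (K.d (-(l + 1)) (-l)) ≅ Arrow.mk (d l) :=
    Arrow.isoMk (C.extendXIso _ (hK (l + 1) _ hl)) (C.extendXIso _ (hK l _ rfl)) (by
      dsimp [K]
      rw [C.extend_d_eq _ (hK (l + 1) _ hl) (hK l _ rfl), hC]
      simp)
  refine ⟨K, fun i hi ↦ ?_, ⟨el ≪≫ (hd' l).some ≪≫ eqToIso hal⟩⟩
  obtain ⟨k, rfl⟩ : ∃ k : ℕ, i = -((k + 1 : ℕ) : ℤ) := ⟨(-i).toNat - 1, by omega⟩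
  have h₂ := hK (k + 2) (-((k + 1 : ℕ) : ℤ) - 1) (by push_cast; ring)
  have h₁ := hK (k + 1) _ rfl
  have h₀ := hK k (-((k + 1 : ℕ) : ℤ) + 1) (by push_cast; ring)
  refine (hd k).of_iso (C.extendXIso _ h₂).symm (C.extendXIso _ h₁).symm
    (C.extendXIso _ h₀).symm ?_ ?_
  · rw [← hC (k + 1)]
    exact C.extend_d_eq _ h₂ h₁
  · rw [← hC k]
    exact C.extend_d_eq _ h₁ h₀

end DKernelResolution

/-! ### Existence of kernels -/

section KernelCondition

variable {A : Type u} [Category.{v} A] [Abelian A] {n : ℕ} {P : ObjectProperty A}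
  (hP : IsNTiltingTorsionClass n P)

include hP

lemma IsNTiltingTorsionClass.isDExactAt_of_isDKernel (K : CochainComplex P.FullSubcategory ℤ)
    (i : ℤ) (h : IsDKernel (inducedExactStructure P) (K.d (i - 1) i) (K.d i (i + 1))) :
    IsDExactAt P ((P.ι.mapHomologicalComplex _).obj K) i := by
  intro W hW w hw
  obtain ⟨N, π, k, hπ, fac⟩ := h.2 ⟨W, hW⟩ (P.homMk w) (P.ι.map_injective hw)
  rw [hP.isDeflation_iff] at hπ
  exact ⟨N.obj, π.hom, k.hom, hπ.1, hπ.2, P.ι.congr_map fac⟩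

/-- The kernel is `opcycles (a - 1)`, in `E` because the complex is exact below `a - 1 = -n`. The
map to `K.X a` need only be mono as seen from `E`. -/
lemma IsNTiltingTorsionClass.hasKernel_of_isDKernel [HasDerivedCategory.{w} A] (hn : 2 ≤ n)
    (K : CochainComplex P.FullSubcategory ℤ)
    (h : ∀ i < 0, IsDKernel (inducedExactStructure P) (K.d (i - 1) i) (K.d i (i + 1)))
    (a b : ℤ) (ha : a = -n + 1) (hb : a + 1 = b) : HasKernel (K.d a b) := by
  subst hb
  let L : CochainComplex A ℤ := (P.ι.mapHomologicalComplex _).obj K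
  have hL (i : ℤ) : P (L.X i) := (K.X i).2
  have hL' (i : ℤ) (hi : i < 0) : IsDExactAt P L i := hP.isDExactAt_of_isDKernel K i (h i hi)
  have hL'' (i : ℤ) (hi : i < a - 1) : L.ExactAt i :=
    hP.exactAt_of_isDExactAt L hL hL' i (by lia)
  have hT : P (L.opcycles (a - 1)) := hP.prop_opcycles L hL (a - 1) hL'' _ le_rfl
  have hT' : P (kernel (L.pOpcycles (a - 1))) :=
    hP.prop_kernel_of_shortExact
      (shortExact_fromOpcycles_pOpcycles L (a - 1 - 1) (a - 1) (by simp) (hL'' _ (by simp)))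
      (hP.prop_opcycles L hL (a - 1) hL'' _ (by simp))
  -- Pulling `f` back along `L.pOpcycles (a - 1)`, whose kernel is in `E`, gives a cycle in degree
  -- `a - 1` on an object of `E`; by `D`-exactness it becomes a boundary, which dies in the
  -- opcycles.
  have zero ⦃W : A⦄ (hW : P W) (f : W ⟶ L.opcycles (a - 1))
      (hf : f ≫ L.fromOpcycles (a - 1) a = 0) : f = 0 := by
    let g := pullback.fst f (L.pOpcycles (a - 1))
    have hf' : f ≫ L.fromOpcycles (a - 1) (a - 1 + 1) = 0 := by
      rw [sub_add_cancel]
      exact hf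
    obtain ⟨N, π, k, _, -, fac⟩ := hL' (a - 1) (by lia)
      (hP.prop_of_prop_kernel g (hP.prop_kernel_pullback_fst _ _ hT') hW)
      (pullback.snd f (L.pOpcycles (a - 1)))
      (by rw [← L.p_fromOpcycles, ← pullback.condition_assoc, hf', comp_zero])
    rw [← cancel_epi g, ← cancel_epi π, comp_zero, comp_zero, pullback.condition, reassoc_of% fac,
      L.d_pOpcycles, comp_zero]
  let κ : (⟨L.opcycles (a - 1), hT⟩ : P.FullSubcategory) ⟶ K.X a :=
    P.homMk (L.fromOpcycles (a - 1) a)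
  have hκ : Mono κ := Preadditive.mono_of_cancel_zero _ (fun {W} f hf ↦
    P.ι.map_injective (zero W.2 f.hom (P.ι.congr_map hf)))
  have hκ' : κ ≫ K.d a (a + 1) = 0 :=
    P.ι.map_injective (L.fromOpcycles_d (a - 1) a (a + 1))
  suffices ∀ (W : P.FullSubcategory) (w : W ⟶ K.X a), w ≫ K.d a (a + 1) = 0 →
      ∃ v, v ≫ κ = w from
    ⟨_, KernelFork.IsLimit.ofι' κ hκ' (fun w hw ↦ ⟨_, (this _ w hw).choose_spec⟩)⟩
  intro W w hw
  -- `D`-exactness at `a = -n + 1` requires `a < 0`, hence `2 ≤ n`. The lift descends along `π`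
  -- because `kernel π` is in `E` and `zero` applies to it.
  obtain ⟨N, π, k, _, hπ, fac⟩ := hL' a (by lia) W.2 w.hom (P.ι.congr_map hw)
  obtain ⟨v, hv⟩ : ∃ v : W.obj ⟶ L.opcycles (a - 1), π ≫ v = k ≫ L.pOpcycles (a - 1) := by
    have : kernel.ι π ≫ k ≫ L.pOpcycles (a - 1) = 0 := zero hπ _ (by
      rw [Category.assoc, Category.assoc, L.p_fromOpcycles, ← fac]
      exact (kernel.condition_assoc π _).trans zero_comp)
    exact ⟨(Abelian.epiIsCokernelOfKernel _ (limit.isLimit _)).desc (CokernelCofork.ofπ _ this),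
      (Abelian.epiIsCokernelOfKernel _ (limit.isLimit _)).fac
        (CokernelCofork.ofπ _ this) WalkingParallelPair.one⟩
  refine ⟨P.homMk v, P.ι.map_injective ?_⟩
  change v ≫ L.fromOpcycles (a - 1) a = w.hom
  refine (cancel_epi π).1 (Eq.trans ?_ fac.symm)
  rw [reassoc_of% hv, L.p_fromOpcycles]

lemma IsNTiltingTorsionClass.hasKernel_of_isDKernelSequence [HasDerivedCategory.{w} A]
    {m : ℕ} (hm : n = m + 2) (S : ComposableArrows P.FullSubcategory (m + 1))
    (hS : IsDKernelSequence (inducedExactStructure P) S) : HasKernel (S.map' 0 1) := by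
  have := hP.hasZeroObject
  obtain ⟨K, hK, ⟨e⟩⟩ := exists_cochainComplex_of_isDKernelSequence hP.hasDKernels S hS
  have := hP.hasKernel_of_isDKernel (by omega) K hK (-(m + 1)) (-m) (by simp [hm]; ring) (by ring)
  have fac : S.map' 0 1 = e.inv.left ≫ K.d (-(m + 1)) (-m) ≫ e.hom.right := by
    refine Eq.trans ?_ (Arrow.w_assoc e.inv e.hom.right).symm
    rw [← Arrow.comp_right, e.inv_hom_id, Arrow.id_right]
    exact (Category.comp_id _).symm
  rw [fac]
  infer_instance

end KernelCondition

end NQuasiAbelian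

end

open NQuasiAbelian in
theorem theoremT {A : Type u} [Category.{v} A] [Abelian A] [HasDerivedCategory.{w} A]
    (n : ℕ) (hn : 1 ≤ n) (P : ObjectProperty A) (hP : IsNTiltingTorsionClass n P) :
    haveI := hP.hasZeroObject
    haveI := hP.hasBinaryBiproducts
    -- `E` is `n`-quasi-abelian
    IsNQuasiAbelian n (inducedExactStructure P) ∧
    -- characterization of the exact sequences with `n` terms in `E`
    (∀ (m : ℕ), n = m + 2 → ∀ S : ComposableArrows P.FullSubcategory (m + 1),
      ((P.ι.mapComposableArrows (m + 1)).obj S).Exact ↔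
        IsDCokernelSequence (inducedExactStructure P) S ∧ HasCokernel (S.map' m (m + 1))) ∧
    -- `K(E)/N` is a triangulated category
    ∃ _ : (acyclicComplexes (inducedExactStructure P)).IsTriangulated,
      -- the canonical triangulated equivalence `Φ : K(E)/N ⥤ D(A)`
      ∃ (Φ : ExactDerivedCategory (inducedExactStructure P) ⥤ DerivedCategory A)
        (_ : Φ.CommShift ℤ)
        (α : quotientFunctor (inducedExactStructure P) ⋙ Φ ≅
          P.ι.mapHomotopyCategory (ComplexShape.up ℤ) ⋙ DerivedCategory.Qh),
        NatTrans.CommShift α.hom ℤ ∧ Φ.IsTriangulated ∧ Φ.IsEquivalence ∧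
        -- the right t-structure on `K(E)/N`, and the equivalence of `A` with its heart
        ∃ t : Triangulated.TStructure (ExactDerivedCategory (inducedExactStructure P)),
          (∀ m : ℤ, t.ge m = rightCoaisle (inducedExactStructure P) m) ∧
          ∃ e : A ≌ t.heart.FullSubcategory,
            Nonempty (P.ι ⋙ e.functor ⋙ t.heart.ι ≅
              (HomotopyCategory.singleFunctors P.FullSubcategory).functor 0 ⋙
                quotientFunctor (inducedExactStructure P)) ∧
            Nonempty (e.functor ⋙ t.heart.ι ⋙ Φ ≅ DerivedCategory.singleFunctor A 0) := by
  have := hP.hasZeroObject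
  have := hP.hasBinaryBiproducts
  have := hP.isTriangulated_acyclicComplexes
  refine ⟨⟨hP.isProjectivelyComplete, hP.isQuillenExact hn, ?_⟩, ?_, this, hP.comparison,
    inferInstance, hP.comparisonFactors, inferInstance, inferInstance, inferInstance,
    hP.tStructure, hP.tStructure_ge, hP.toHeart.asEquivalence, ⟨hP.ιCompToHeart⟩,
    ⟨hP.toHeartCompComparison⟩⟩
  · obtain _ | _ | m := n
    · omega
    · exact hP.nQuasiAbelianCondition_one
    · exact ⟨hP.hasDKernels, hP.hasDCokernels hn,
        fun S hS ↦ hP.hasKernel_of_isDKernelSequence rfl S hS,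
        fun S hS ↦ hP.hasCokernel_of_exact rfl S ((hP.exact_map_iff_isDCokernelSequence hn S).2 hS)⟩
  · intro m hm S
    rw [hP.exact_map_iff_isDCokernelSequence hn S]
    -- The cokernel exists as soon as the sequence is exact, so it plays no role in the converse.
    refine ⟨fun hS ↦ ⟨hS, hP.hasCokernel_of_exact hm S ?_⟩, fun hS ↦ hS.1⟩
    exact (hP.exact_map_iff_isDCokernelSequence hn S).2 hS
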